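/- Let $\Gamma$ be a countable (discrete) sofic group, let $\mathcal U$ be a free ultrafilter on $\mathbb N$, and let $\alpha\in\mathrm{Aut}(\Gamma\times\Gamma)$ be the flip, $\alpha(g,h)=(h,g)$. For $n\ge 1$ let $\mathbb S_n$ be the symmetric group on $n$ letters with the normalized Hamming distance $d_n(\sigma,\tau)=\frac1n|\{j:\sigma(j)\ne\tau(j)\}|$. $\Gamma$ is sofic if for every finite $F\subseteq\Gamma$ and $\varepsilon>0$ there are $n\ge1$ and a map $\varphi:\Gamma\to\mathbb S_n$ with $d_n(\varphi(gh),\varphi(g)\varphi(h))\le\varepsilon$ for all $g,h\in F$ and $d_n(\varphi(g),1)\ge 1-\varepsilon$ for all $g\in F\setminus\{1\}$. $\Gamma$ is amenable if for every finite $F\subseteq\Gamma$ and $\varepsilon>0$ there is a nonempty finite $A\subseteq\Gamma$ with $|gA\,\triangle\, A|\le\varepsilon|A|$ for all $g\in F$. A universal sofic group is a metric ultraproduct $$\mathcal S=\prod_{k\to\mathcal U}\mathbb S_{n_k}=\Big(\prod_{k}\mathbb S_{n_k}\Big)\Big/\Big\{(\sigma_k)_k:\lim_{k\to\mathcal U}d_{n_k}(\sigma_k,1)=0\Big\}$$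 for a sequence $(n_k)_k$ of positive integers. A sofic representation of a group $\Lambda$ in $\mathcal S$ is an injective homomorphism $\pi:\Lambda\to\mathcal S$ such that $\lim_{k\to\mathcal U}d_{n_k}(g_k,1)=1$ for every $g\in\Lambda\setminus\{1\}$, where $\pi(g)=(g_k)_{\mathcal U}$. Two homomorphisms $\pi_1,\pi_2:\Lambda\to\mathcal S$ are conjugate if there is $s\in\mathcal S$ with $\pi_2(g)=s\,\pi_1(g)\,s^{-1}$ for all $g\in\Lambda$. The following are equivalent: 1. $\Gamma$ is amenable; 2. for any universal sofic group $\mathcal S$, any two sofic representations $\pi_1,\pi_2:\Gamma\to\mathcal S$ are conjugate; 3. for any universal sofic group $\mathcal S$ and any sofic representation $\pi:\Gamma\times\Gamma\to\mathcal S$, $\pi$ and $\pi\circ\alpha$ are conjugate; 4. for any universal sofic group $\mathcal S$ and any sofic representation $\pi:\Gamma\times\Gamma\to\mathcal S$, the restrictions $\pi|_{\Gamma\times 1}$ and $(\pi\circ\alpha)|_{\Gamma\times 1}$ are conjugate. -/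

import Mathlib

open Filter Topology
open scoped Pointwise symmDiff

noncomputable section

namespace Sofic

/-- The normalized Hamming distance on the symmetric group on `n` letters:
`d_n(σ, τ) = n⁻¹ * #{j | σ j ≠ τ j}`. -/
def normHamming {n : ℕ} (σ τ : Equiv.Perm (Fin n)) : ℝ :=
  (hammingDist (fun j => σ j) (fun j => τ j) : ℝ) / (n : ℝ)

theorem normHamming_self {n : ℕ} (σ : Equiv.Perm (Fin n)) : normHamming σ σ = 0 := by
  simp [normHamming]

theorem normHamming_nonneg {n : ℕ} (σ τ : Equiv.Perm (Fin n)) : 0 ≤ normHamming σ τ := by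
  unfold normHamming
  positivity

theorem normHamming_comm {n : ℕ} (σ τ : Equiv.Perm (Fin n)) :
    normHamming σ τ = normHamming τ σ := by
  unfold normHamming
  rw [hammingDist_comm]

theorem normHamming_triangle {n : ℕ} (σ τ ρ : Equiv.Perm (Fin n)) :
    normHamming σ ρ ≤ normHamming σ τ + normHamming τ ρ := by
  unfold normHamming
  rw [← add_div]
  gcongr
  exact_mod_cast hammingDist_triangle _ _ _

theorem normHamming_mul_left {n : ℕ} (ρ σ τ : Equiv.Perm (Fin n)) :
    normHamming (ρ * σ) (ρ * τ) = normHamming σ τ := by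
  simp [normHamming, hammingDist]

theorem normHamming_mul_right {n : ℕ} (ρ σ τ : Equiv.Perm (Fin n)) :
    normHamming (σ * ρ) (τ * ρ) = normHamming σ τ := by
  have h : hammingDist (fun j => (σ * ρ) j) (fun j => (τ * ρ) j)
      = hammingDist (fun j => σ j) (fun j => τ j) := by
    unfold hammingDist
    refine Finset.card_bij (fun j _ => ρ j) ?_ ?_ ?_
    · intro j hj
      rw [Finset.mem_filter] at hj ⊢
      exact ⟨Finset.mem_univ _, hj.2⟩
    · intro a _ b _ hab
      exact ρ.injective hab
    · intro b hb
      refine ⟨ρ.symm b, ?_, ρ.apply_symm_apply b⟩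
      rw [Finset.mem_filter] at hb ⊢
      refine ⟨Finset.mem_univ _, ?_⟩
      simpa only [Equiv.Perm.mul_apply, Equiv.apply_symm_apply] using hb.2
  unfold normHamming
  rw [h]

/-- The sequences of permutations that are at distance tending to `0` from the identity
along the ultrafilter `𝒰`. -/
def nullSubgroup (𝒰 : Ultrafilter ℕ) (n : ℕ → ℕ) :
    Subgroup (∀ k, Equiv.Perm (Fin (n k))) where
  carrier := {σ | Tendsto (fun k => normHamming (σ k) 1) (𝒰 : Filter ℕ) (𝓝 0)}
  one_mem' := by
    simp [normHamming_self]
  mul_mem' := by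
    intro σ τ hσ hτ
    simp only [Set.mem_ofPred_eq] at hσ hτ ⊢
    have h := hσ.add hτ
    rw [add_zero] at h
    refine squeeze_zero (fun k => normHamming_nonneg _ _) (fun k => ?_) h
    have h1 := normHamming_triangle (σ k * τ k) (τ k) 1
    have h2 := normHamming_mul_right (τ k) (σ k) 1
    rw [one_mul] at h2
    rw [h2] at h1
    exact h1
  inv_mem' := by
    intro σ hσ
    simp only [Set.mem_ofPred_eq] at hσ ⊢
    refine hσ.congr (fun k => ?_)
    have h := normHamming_mul_left (σ k) (σ k)⁻¹ 1
    rw [mul_inv_cancel, mul_one] at h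
    rw [Pi.inv_apply, ← h, normHamming_comm]

instance nullSubgroup_normal (𝒰 : Ultrafilter ℕ) (n : ℕ → ℕ) :
    (nullSubgroup 𝒰 n).Normal where
  conj_mem := by
    intro σ hσ τ
    change Tendsto _ _ _ at hσ
    change Tendsto _ _ _
    refine hσ.congr (fun k => ?_)
    have h1 := normHamming_mul_left (τ k) (σ k) 1
    have h2 := normHamming_mul_right (τ k)⁻¹ (τ k * σ k) (τ k * 1)
    rw [mul_one, mul_inv_cancel] at h2
    rw [mul_one] at h1
    rw [Pi.mul_apply, Pi.mul_apply, Pi.inv_apply, h2, h1]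

/-- The universal sofic group `∏_{k → 𝒰} S_{n_k}`: the metric ultraproduct of the symmetric groups
on `n k` letters with their normalized Hamming distances. -/
abbrev UniversalSoficGroup (𝒰 : Ultrafilter ℕ) (n : ℕ → ℕ) : Type :=
  (∀ k, Equiv.Perm (Fin (n k))) ⧸ nullSubgroup 𝒰 n

/-- A sofic representation: an injective homomorphism into a universal sofic group such that,
whenever `g ≠ 1` is sent to the class of a sequence `σ`, one has `lim_{k → 𝒰} d(σ k, 1) = 1`. -/
def IsSoficRepresentation {Γ : Type*} [Group Γ] {𝒰 : Ultrafilter ℕ} {n : ℕ → ℕ}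
    (π : Γ →* UniversalSoficGroup 𝒰 n) : Prop :=
  Function.Injective π ∧
    ∀ g : Γ, g ≠ 1 → ∀ σ : ∀ k, Equiv.Perm (Fin (n k)),
      (QuotientGroup.mk σ : UniversalSoficGroup 𝒰 n) = π g →
        Tendsto (fun k => normHamming (σ k) 1) (𝒰 : Filter ℕ) (𝓝 1)

/-- Two homomorphisms into the same group are conjugate if they differ by an inner automorphism
of the target. -/
def AreConjugate {Γ S : Type*} [Group Γ] [Group S] (π₁ π₂ : Γ →* S) : Prop :=
  ∃ s : S, ∀ g : Γ, π₂ g = s * π₁ g * s⁻¹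

/-- Sofic groups: every finite part of the multiplication table can be modelled, up to `ε` in
normalized Hamming distance, by permutations of a finite nonempty set, in such a way that every
nontrivial element of the finite part moves all but an `ε` fraction of the points. -/
def IsSofic (Γ : Type*) [Group Γ] : Prop :=
  ∀ (F : Finset Γ) (ε : ℝ), 0 < ε →
    ∃ (n : ℕ) (φ : Γ → Equiv.Perm (Fin n)), 0 < n ∧
      (∀ g ∈ F, ∀ h ∈ F, normHamming (φ (g * h)) (φ g * φ h) ≤ ε) ∧
      (∀ g ∈ F, g ≠ 1 → 1 - ε ≤ normHamming (φ g) 1)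

open Classical in
/-- Amenability of a discrete group: for every finite set `F` and every `ε > 0` there is a
nonempty finite set `A` with `|gA ∆ A| ≤ ε |A|` for all `g ∈ F`. -/
def IsAmenable (Γ : Type*) [Group Γ] : Prop :=
  ∀ (F : Finset Γ) (ε : ℝ), 0 < ε →
    ∃ A : Finset Γ, A.Nonempty ∧
      ∀ g ∈ F, (((g • A) ∆ A).card : ℝ) ≤ ε * (A.card : ℝ)

/-- The flip automorphism `(g, h) ↦ (h, g)` of `Γ × Γ`. -/
def flip (Γ : Type*) [Group Γ] : Γ × Γ ≃* Γ × Γ :=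
  MulEquiv.prodComm

end Sofic

end

namespace Sofic

/-! The substance is 1 → 2 and 4 → 1. Amenability passes to `Γ × Γ`, so uniqueness up to conjugacy
also gives 3; restricting to the first factor gives 4 from either 2 or 3.

Amenable groups: lift two representations to permutations `σ k`, `τ k`, which are multiplicative and
free at most points. For a Følner set `T` and good centres `c`, `d`, the map `σ t c ↦ τ t d` on the
tiles `T c`, `T d` is almost equivariant. Tiles are placed greedily in both spaces at once, each
nearly disjoint from what is already covered (`TileMatching.addTile`). A centre exists by averaging
as long as the previous layer of tiles is nearly `T`-invariant (`exists_center`). Each layer covers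
a fixed fraction of what was left, so finitely many layers match almost everything
(`IsFreeApprox.eventually_exists_tileMatching`). The matching extends to an almost conjugating
permutation, and a diagonal choice gives an element of the ultraproduct.

Non-amenable groups: choose an approximation `φ` on `n` points, then an approximation `ψ` on `m`
points so accurate that most points are good out to word radius `n + 1`. The product action is a
sofic representation of `Γ × Γ`. The first factor preserves slices of size `n`; if it were conjugate
to the second, most slices would become sets of `n` good points with small boundary under `ψ`.
Expansion of finite subsets of `Γ` transfers to such sets (`card_le_boundary_of_goodAt`), a
contradiction (`false_of_conj_of_expanding`). -/

/-! ### Hamming distance as a count; good points -/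

open Classical in
theorem normHamming_eq_card {n : ℕ} (σ τ : Equiv.Perm (Fin n)) :
    normHamming σ τ = ((Finset.univ.filter fun x => σ x ≠ τ x).card : ℝ) / n := by
  unfold normHamming hammingDist
  congr!

open Classical in
theorem card_ne_le_of_normHamming_le {n : ℕ} {σ τ : Equiv.Perm (Fin n)} {ε : ℝ}
    (h : normHamming σ τ ≤ ε) :
    ((Finset.univ.filter fun x => σ x ≠ τ x).card : ℝ) ≤ ε * n := by
  rw [normHamming_eq_card] at h
  rcases Nat.eq_zero_or_pos n with rfl | hn
  · simp
  · rwa [div_le_iff₀ (by exact_mod_cast hn)] at h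

open Classical in
theorem normHamming_le_of_card_ne_le {n : ℕ} (hn : 0 < n) {σ τ : Equiv.Perm (Fin n)} {ε : ℝ}
    (h : ((Finset.univ.filter fun x => σ x ≠ τ x).card : ℝ) ≤ ε * n) :
    normHamming σ τ ≤ ε := by
  rw [normHamming_eq_card, div_le_iff₀ (by exact_mod_cast hn)]
  exact h

open Classical in
theorem card_eq_le_of_le_normHamming {n : ℕ} {σ τ : Equiv.Perm (Fin n)} {ε : ℝ}
    (h : 1 - ε ≤ normHamming σ τ) :
    ((Finset.univ.filter fun x => σ x = τ x).card : ℝ) ≤ ε * n := by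
  rw [normHamming_eq_card] at h
  rcases Nat.eq_zero_or_pos n with rfl | hn
  · simp
  · rw [le_div_iff₀ (by exact_mod_cast hn)] at h
    have h1 := Finset.card_filter_add_card_filter_not (s := (Finset.univ : Finset (Fin n)))
      (fun x => σ x = τ x)
    rw [Finset.card_univ, Fintype.card_fin] at h1
    have h2 : ((Finset.univ.filter fun x => σ x = τ x).card : ℝ)
        + ((Finset.univ.filter fun x => ¬ σ x = τ x).card : ℝ) = n := by exact_mod_cast h1
    simp only [ne_eq] at h
    linarith

theorem normHamming_le_one {n : ℕ} (σ τ : Equiv.Perm (Fin n)) : normHamming σ τ ≤ 1 := by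
  unfold normHamming
  refine div_le_one_of_le₀ ?_ (by positivity)
  exact_mod_cast (hammingDist_le_card_fintype).trans (by simp)

/-- The point `x` is good for `σ` and `L` if, seen from `x`, the map `σ` is multiplicative and
free on `L`. -/
def GoodAt {Γ X : Type*} [Group Γ] (σ : Γ → Equiv.Perm X) (L : Finset Γ) (x : X) : Prop :=
  (∀ g ∈ L, ∀ h ∈ L, σ (g * h) x = σ g (σ h x)) ∧ Set.InjOn (fun g => σ g x) L

theorem GoodAt.map_one {Γ X : Type*} [Group Γ] {σ : Γ → Equiv.Perm X} {L : Finset Γ} {x : X}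
    (h : GoodAt σ L x) (h1 : 1 ∈ L) : σ 1 x = x := by
  have := h.1 1 h1 1 h1
  rw [one_mul] at this
  exact ((σ 1).injective this).symm

-- Union bound over the `|L|²` pairs: each contributes at most `ε n` failures of multiplicativity
-- and at most `ε n` collisions.
open Classical in
theorem card_not_goodAt_le {Γ : Type*} [Group Γ] {n : ℕ} {σ : Γ → Equiv.Perm (Fin n)}
    {L : Finset Γ} {ε : ℝ}
    (hm : ∀ g ∈ L, ∀ h ∈ L, normHamming (σ (g * h)) (σ g * σ h) ≤ ε)
    (hf : ∀ g ∈ L, ∀ h ∈ L, g ≠ h → 1 - ε ≤ normHamming (σ g) (σ h)) (hε : 0 ≤ ε) :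
    ((Finset.univ.filter fun x => ¬ GoodAt σ L x).card : ℝ) ≤ 2 * (L.card : ℝ) ^ 2 * ε * n := by
  have hsub : (Finset.univ.filter fun x => ¬ GoodAt σ L x) ⊆
      (L ×ˢ L).biUnion (fun p =>
        (Finset.univ.filter fun x => σ (p.1 * p.2) x ≠ (σ p.1 * σ p.2) x) ∪
        (Finset.univ.filter fun x => p.1 ≠ p.2 ∧ σ p.1 x = σ p.2 x)) := by
    intro x hx
    rw [Finset.mem_filter] at hx
    by_contra hc
    apply hx.2
    simp only [Finset.mem_biUnion, Finset.mem_product, Finset.mem_union, Finset.mem_filter,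
      Finset.mem_univ, true_and, not_exists, not_and, not_or, not_not, Prod.forall] at hc
    refine ⟨fun g hg h hh => ?_, fun g hg h hh he => ?_⟩
    · exact (hc g h ⟨hg, hh⟩).1
    · by_contra hne
      exact (hc g h ⟨hg, hh⟩).2 hne he
  have h1 := (Finset.card_le_card hsub).trans Finset.card_biUnion_le
  have h2 : ∀ p ∈ L ×ˢ L, (((Finset.univ.filter fun x => σ (p.1 * p.2) x ≠ (σ p.1 * σ p.2) x) ∪
        (Finset.univ.filter fun x => p.1 ≠ p.2 ∧ σ p.1 x = σ p.2 x)).card : ℝ) ≤ 2 * ε * n := by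
    intro p hp
    rw [Finset.mem_product] at hp
    have ha := card_ne_le_of_normHamming_le (hm p.1 hp.1 p.2 hp.2)
    have hb : ((Finset.univ.filter fun x => p.1 ≠ p.2 ∧ σ p.1 x = σ p.2 x).card : ℝ) ≤ ε * n := by
      by_cases h : p.1 = p.2
      · simp only [h, ne_eq, not_true_eq_false, false_and, Finset.filter_false, Finset.card_empty,
          Nat.cast_zero]
        positivity
      · simpa [h] using card_eq_le_of_le_normHamming (hf p.1 hp.1 p.2 hp.2 h)
    have hc : (((Finset.univ.filter fun x => σ (p.1 * p.2) x ≠ (σ p.1 * σ p.2) x) ∪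
        (Finset.univ.filter fun x => p.1 ≠ p.2 ∧ σ p.1 x = σ p.2 x)).card : ℝ) ≤ _ :=
      Nat.cast_le.mpr (Finset.card_union_le _ _)
    rw [Nat.cast_add] at hc
    linarith
  calc ((Finset.univ.filter fun x => ¬ GoodAt σ L x).card : ℝ) ≤ _ := Nat.cast_le.mpr h1
    _ = ∑ p ∈ L ×ˢ L, _ := by push_cast; rfl
    _ ≤ ∑ p ∈ L ×ˢ L, 2 * ε * n := Finset.sum_le_sum h2
    _ = 2 * (L.card : ℝ) ^ 2 * ε * n := by
      rw [Finset.sum_const, Finset.card_product]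
      push_cast [nsmul_eq_mul]
      ring

/-! ### Følner sets and one-sided boundaries -/

-- Translation preserves cardinality, so the two halves of the symmetric difference have equal size.
open Classical in
theorem card_symmDiff_smul_le {Γ : Type*} [Group Γ] (g : Γ) (A : Finset Γ) :
    ((g • A) ∆ A).card = 2 * (A.filter fun a => g * a ∉ A).card := by
  have h1 : ((g • A) \ A).card = (A.filter fun a => g * a ∉ A).card := by
    rw [← Finset.card_image_of_injective (A.filter fun a => g * a ∉ A) (mul_right_injective g)]
    congr 1
    ext x
    simp only [Finset.mem_sdiff, Finset.mem_smul_finset, Finset.mem_image, Finset.mem_filter,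
      smul_eq_mul]
    constructor
    · rintro ⟨⟨y, hy, rfl⟩, hx⟩
      exact ⟨y, ⟨hy, hx⟩, rfl⟩
    · rintro ⟨y, ⟨hy, hx⟩, rfl⟩
      exact ⟨⟨y, hy, rfl⟩, hx⟩
  have h2 : (A \ (g • A)).card = ((g • A) \ A).card :=
    Finset.card_sdiff_comm (by rw [Finset.card_smul_finset])
  rw [symmDiff_def, Finset.sup_eq_union, Finset.card_union_of_disjoint disjoint_sdiff_sdiff, h2, h1]
  ring

open Classical in
theorem isAmenable_iff {Γ : Type*} [Group Γ] :
    IsAmenable Γ ↔ ∀ (F : Finset Γ) (η : ℝ), 0 < η → ∃ T : Finset Γ, T.Nonempty ∧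
      ∀ g ∈ F, ((T.filter fun t => g * t ∉ T).card : ℝ) ≤ η * T.card := by
  constructor
  · intro h F η hη
    obtain ⟨T, hT, h⟩ := h F η hη
    refine ⟨T, hT, fun g hg => ?_⟩
    have := h g hg
    rw [card_symmDiff_smul_le] at this
    push_cast at this
    have h0 : (0 : ℝ) ≤ (T.filter fun t => g * t ∉ T).card := by positivity
    linarith
  · intro h F η hη
    obtain ⟨T, hT, h⟩ := h F (η / 2) (by positivity)
    refine ⟨T, hT, fun g hg => ?_⟩
    have := h g hg
    rw [card_symmDiff_smul_le]
    push_cast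
    linarith

theorem IsAmenable.prod {Γ Λ : Type*} [Group Γ] [Group Λ] (hΓ : IsAmenable Γ)
    (hΛ : IsAmenable Λ) : IsAmenable (Γ × Λ) := by
  classical
  rw [isAmenable_iff] at *
  intro F η hη
  obtain ⟨S, hS, h1⟩ := hΓ (F.image Prod.fst) (η / 2) (by positivity)
  obtain ⟨T, hT, h2⟩ := hΛ (F.image Prod.snd) (η / 2) (by positivity)
  refine ⟨S ×ˢ T, hS.product hT, fun g hg => ?_⟩
  have h1 := h1 g.1 (Finset.mem_image_of_mem _ hg)
  have h2 := h2 g.2 (Finset.mem_image_of_mem _ hg)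
  have hsub : ((S ×ˢ T).filter fun t => g * t ∉ S ×ˢ T) ⊆
      (S.filter fun s => g.1 * s ∉ S) ×ˢ T ∪ S ×ˢ (T.filter fun t => g.2 * t ∉ T) := by
    intro p hp
    simp only [Finset.mem_filter, Finset.mem_product, Finset.mem_union, Prod.fst_mul,
      Prod.snd_mul] at hp ⊢
    tauto
  have h3 := Nat.cast_le (α := ℝ).mpr
    ((Finset.card_le_card hsub).trans (Finset.card_union_le _ _))
  rw [Nat.cast_add, Finset.card_product, Finset.card_product, Nat.cast_mul, Nat.cast_mul] at h3
  refine le_trans (le_of_eq ?_) (h3.trans ?_)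
  · congr!
  · rw [Finset.card_product, Nat.cast_mul]
    have hs : (0 : ℝ) ≤ S.card := by positivity
    have ht : (0 : ℝ) ≤ T.card := by positivity
    have e1 := mul_le_mul_of_nonneg_right h1 ht
    have e2 := mul_le_mul_of_nonneg_left h2 hs
    refine (add_le_add e1 e2).trans (le_of_eq ?_)
    ring

/-! ### Simultaneous quasi-tilings -/

open Classical in
/-- A partial matching `E` between the supports `A` and `B` of two families of tiles of total
nominal size `P`, one for `σ` and one for `τ`, which is nearly equivariant under `F`; the supports
are nearly invariant under `K`. -/
structure TileMatching {Γ X : Type*} [Fintype X] (σ τ : Γ → Equiv.Perm X)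
    (F : Finset Γ) (ε : ℝ) (K : Finset Γ) (η : ℝ) (A B : Finset X) (E : Finset (X × X))
    (P : ℕ) : Prop where
  fst_mem : ∀ p ∈ E, p.1 ∈ A
  snd_mem : ∀ p ∈ E, p.2 ∈ B
  fst_inj : Set.InjOn Prod.fst (E : Set (X × X))
  snd_inj : Set.InjOn Prod.snd (E : Set (X × X))
  card_left : A.card ≤ P
  card_right : B.card ≤ P
  le_card : (1 - 2 * ε) * P ≤ E.card
  inv_left : ∀ g ∈ K, ((A.filter fun x => σ g x ∉ A).card : ℝ) ≤ η * P
  inv_right : ∀ g ∈ K, ((B.filter fun x => τ g x ∉ B).card : ℝ) ≤ η * P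
  equivariant : ∀ f ∈ F, ((E.filter fun p => (σ f p.1, τ f p.2) ∉ E).card : ℝ) ≤ 3 * ε * P

theorem TileMatching.empty {Γ X : Type*} [Fintype X] (σ τ : Γ → Equiv.Perm X)
    (F : Finset Γ) (ε : ℝ) (K : Finset Γ) (η : ℝ) :
    TileMatching σ τ F ε K η ∅ ∅ ∅ 0 := by
  constructor <;> simp

theorem TileMatching.mono {Γ X : Type*} [Fintype X] {σ τ : Γ → Equiv.Perm X}
    {F : Finset Γ} {ε : ℝ} {K K' : Finset Γ} {η η' : ℝ} {A B : Finset X} {E : Finset (X × X)}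
    {P : ℕ} (h : TileMatching σ τ F ε K η A B E P) (hK : K' ⊆ K) (hη : η ≤ η') :
    TileMatching σ τ F ε K' η' A B E P where
  __ := h
  inv_left g hg := (h.inv_left g (hK hg)).trans (by gcongr)
  inv_right g hg := (h.inv_right g (hK hg)).trans (by gcongr)

open Classical in
theorem card_union_tile_boundary_le {Γ X : Type*} [Group Γ] {σ : Γ → Equiv.Perm X}
    {g : Γ} {η : ℝ} {A : Finset X} {P : ℕ} {T : Finset Γ} {c : X}
    (hA : ((A.filter fun x => σ g x ∉ A).card : ℝ) ≤ η * P)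
    (hT : ((T.filter fun t => g * t ∉ T).card : ℝ) ≤ η * T.card)
    (hc : ∀ t ∈ T, σ (g * t) c = σ g (σ t c)) :
    (((A ∪ T.image fun t => σ t c).filter
      fun x => σ g x ∉ A ∪ T.image fun t => σ t c).card : ℝ) ≤ η * (P + T.card : ℕ) := by
  have hsub : ((A ∪ T.image fun t => σ t c).filter fun x => σ g x ∉ A ∪ T.image fun t => σ t c) ⊆
      (A.filter fun x => σ g x ∉ A) ∪ (T.filter fun t => g * t ∉ T).image fun t => σ t c := by
    intro x hx
    simp only [Finset.mem_filter, Finset.mem_union, Finset.mem_image, not_or] at hx ⊢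
    obtain ⟨hx | ⟨t, ht, rfl⟩, h1, h2⟩ := hx
    · exact Or.inl ⟨hx, h1⟩
    · refine Or.inr ⟨t, ⟨ht, fun h => h2 ⟨_, h, hc t ht⟩⟩, rfl⟩
  have h1 : (((A ∪ T.image fun t => σ t c).filter
      fun x => σ g x ∉ A ∪ T.image fun t => σ t c).card : ℝ) ≤ _ :=
    Nat.cast_le.mpr ((Finset.card_le_card hsub).trans
      ((Finset.card_union_le _ _).trans (add_le_add_right Finset.card_image_le _)))
  push_cast at h1 ⊢
  linarith

-- Only those `t` are matched for which both new points are fresh, which costs at most `2 ε |T|`. A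
-- new pair is moved off the matching by `f` only if `f t` leaves `T` (at most `ε |T|`) or is one of
-- the discarded elements (at most `2 ε |T|`), whence the constant `3 ε`.
open Classical in
theorem TileMatching.addTile {Γ X : Type*} [Group Γ] [Fintype X] {σ τ : Γ → Equiv.Perm X}
    {F : Finset Γ} {ε : ℝ} {K : Finset Γ} {η : ℝ} {A B : Finset X} {E : Finset (X × X)}
    {P : ℕ} (h : TileMatching σ τ F ε K η A B E P) {T : Finset Γ} {c d : X}
    (hTK : ∀ g ∈ K, ((T.filter fun t => g * t ∉ T).card : ℝ) ≤ η * T.card)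
    (hTF : ∀ g ∈ F, ((T.filter fun t => g * t ∉ T).card : ℝ) ≤ ε * T.card)
    (hc : GoodAt σ (T ∪ (K ∪ F)) c) (hd : GoodAt τ (T ∪ (K ∪ F)) d)
    (hcA : ((T.filter fun t => σ t c ∈ A).card : ℝ) ≤ ε * T.card)
    (hdB : ((T.filter fun t => τ t d ∈ B).card : ℝ) ≤ ε * T.card) :
    TileMatching σ τ F ε K η (A ∪ T.image fun t => σ t c) (B ∪ T.image fun t => τ t d)
      (E ∪ (T.filter fun t => σ t c ∉ A ∧ τ t d ∉ B).image fun t => (σ t c, τ t d))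
      (P + T.card) := by
  have hTL : ∀ t ∈ T, t ∈ T ∪ (K ∪ F) := fun t ht => Finset.mem_union_left _ ht
  have hKL : ∀ t ∈ K, t ∈ T ∪ (K ∪ F) := fun t ht =>
    Finset.mem_union_right _ (Finset.mem_union_left _ ht)
  have hFL : ∀ t ∈ F, t ∈ T ∪ (K ∪ F) := fun t ht =>
    Finset.mem_union_right _ (Finset.mem_union_right _ ht)
  set G := T.filter fun t => σ t c ∉ A ∧ τ t d ∉ B with hG
  have hGT : ∀ t ∈ G, t ∈ T := fun t ht => (Finset.mem_filter.mp ht).1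
  have hcard : (T.card : ℝ) ≤ G.card + 2 * ε * T.card := by
    have hsub : T ⊆ G ∪ ((T.filter fun t => σ t c ∈ A) ∪ (T.filter fun t => τ t d ∈ B)) := by
      intro t ht
      simp only [hG, Finset.mem_union, Finset.mem_filter]
      tauto
    have h1 : (T.card : ℝ) ≤ _ := Nat.cast_le.mpr ((Finset.card_le_card hsub).trans
      ((Finset.card_union_le _ _).trans (add_le_add_right (Finset.card_union_le _ _) _)))
    push_cast at h1
    linarith
  have hinj : Set.InjOn (fun t => (σ t c, τ t d)) (G : Set Γ) := by
    intro s hs t ht hst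
    exact hc.2 (hTL s (hGT s hs)) (hTL t (hGT t ht)) (congrArg Prod.fst hst)
  constructor
  · intro p hp
    simp only [Finset.mem_union, Finset.mem_image] at hp ⊢
    obtain hp | ⟨t, ht, rfl⟩ := hp
    · exact Or.inl (h.fst_mem p hp)
    · exact Or.inr ⟨t, hGT t ht, rfl⟩
  · intro p hp
    simp only [Finset.mem_union, Finset.mem_image] at hp ⊢
    obtain hp | ⟨t, ht, rfl⟩ := hp
    · exact Or.inl (h.snd_mem p hp)
    · exact Or.inr ⟨t, hGT t ht, rfl⟩
  · intro p hp q hq hpq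
    simp only [Finset.coe_union, Finset.coe_image, Set.mem_union, Set.mem_image,
      Finset.mem_coe] at hp hq
    obtain hp | ⟨t, ht, rfl⟩ := hp <;> obtain hq | ⟨s, hs, rfl⟩ := hq
    · exact h.fst_inj hp hq hpq
    · exact absurd ((show p.1 = σ s c from hpq) ▸ h.fst_mem p hp) (Finset.mem_filter.mp hs).2.1
    · exact absurd ((show q.1 = σ t c from hpq.symm) ▸ h.fst_mem q hq) (Finset.mem_filter.mp ht).2.1
    · rw [hc.2 (hTL t (hGT t ht)) (hTL s (hGT s hs)) hpq]
  · intro p hp q hq hpq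
    simp only [Finset.coe_union, Finset.coe_image, Set.mem_union, Set.mem_image,
      Finset.mem_coe] at hp hq
    obtain hp | ⟨t, ht, rfl⟩ := hp <;> obtain hq | ⟨s, hs, rfl⟩ := hq
    · exact h.snd_inj hp hq hpq
    · exact absurd ((show p.2 = τ s d from hpq) ▸ h.snd_mem p hp) (Finset.mem_filter.mp hs).2.2
    · exact absurd ((show q.2 = τ t d from hpq.symm) ▸ h.snd_mem q hq) (Finset.mem_filter.mp ht).2.2
    · rw [hd.2 (hTL t (hGT t ht)) (hTL s (hGT s hs)) hpq]
  · exact (Finset.card_union_le _ _).trans (add_le_add h.card_left Finset.card_image_le)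
  · exact (Finset.card_union_le _ _).trans (add_le_add h.card_right Finset.card_image_le)
  · rw [Finset.card_union_of_disjoint, Finset.card_image_of_injOn hinj]
    · push_cast
      have := h.le_card
      linarith
    · rw [Finset.disjoint_left]
      intro p hp hq
      obtain ⟨t, ht, rfl⟩ := Finset.mem_image.mp hq
      exact (Finset.mem_filter.mp ht).2.1 (h.fst_mem _ hp)
  · intro g hg
    exact card_union_tile_boundary_le (h.inv_left g hg) (hTK g hg)
      fun t ht => hc.1 g (hKL g hg) t (hTL t ht)
  · intro g hg
    exact card_union_tile_boundary_le (h.inv_right g hg) (hTK g hg)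
      fun t ht => hd.1 g (hKL g hg) t (hTL t ht)
  · intro f hf
    have hsub : ((E ∪ G.image fun t => (σ t c, τ t d)).filter
          fun p => (σ f p.1, τ f p.2) ∉ E ∪ G.image fun t => (σ t c, τ t d)) ⊆
        (E.filter fun p => (σ f p.1, τ f p.2) ∉ E) ∪
          ((T.filter fun t => f * t ∉ T) ∪ (T.filter fun t => f * t ∈ T \ G)).image
            fun t => (σ t c, τ t d) := by
      intro p hp
      simp only [Finset.mem_filter, Finset.mem_union, Finset.mem_image, not_or] at hp ⊢
      obtain ⟨hp | ⟨t, ht, rfl⟩, h1, h2⟩ := hp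
      · exact Or.inl ⟨hp, h1⟩
      · refine Or.inr ⟨t, ?_, rfl⟩
        have : f * t ∉ G := fun hft => h2 ⟨f * t, hft, by
          rw [hc.1 f (hFL f hf) t (hTL t (hGT t ht)), hd.1 f (hFL f hf) t (hTL t (hGT t ht))]⟩
        have := hGT t ht
        rw [Finset.mem_sdiff]
        tauto
    have h1 := Nat.cast_le (α := ℝ).mpr ((Finset.card_le_card hsub).trans
      ((Finset.card_union_le _ _).trans (add_le_add_right
        (Finset.card_image_le.trans (Finset.card_union_le _ _)) _)))
    have h2 : (T.filter fun t => f * t ∈ T \ G).card ≤ (T \ G).card :=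
      Finset.card_le_card_of_injOn (fun t => f * t) (fun t ht => (Finset.mem_filter.mp ht).2)
        (mul_right_injective f).injOn
    have h3 : ((T \ G).card : ℝ) + G.card = T.card := by
      exact_mod_cast Finset.card_sdiff_add_card_eq_card (Finset.filter_subset _ T)
    have h4 : ((T.filter fun t => f * t ∈ T \ G).card : ℝ) ≤ (T \ G).card := by exact_mod_cast h2
    have h5 := hTF f hf
    have h6 := h.equivariant f hf
    push_cast at h1 ⊢
    linarith

/-- If `A₀` is nearly invariant under `T`, then some good point has most of its translates by `T`
outside a set that is not much larger than `A₀`. -/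
theorem exists_center {Γ X : Type*} [Group Γ] [Fintype X] {σ : Γ → Equiv.Perm X}
    {ε : ℝ} (hε : 0 < ε) {T L : Finset Γ} (hT : T.Nonempty) {A₀ A : Finset X} {P₀ P : ℕ}
    [DecidablePred fun x => ¬ GoodAt σ L x] [DecidableEq X]
    (hA₀ : A₀.card ≤ P₀) (hAA : ((A \ A₀).card : ℝ) ≤ P - P₀)
    (hinv : ∀ t ∈ T, ((A₀.filter fun x => σ t x ∉ A₀).card : ℝ) ≤ ε ^ 2 / 4 * P₀)
    (hbad : ((Finset.univ.filter fun x => ¬ GoodAt σ L x).card : ℝ) ≤ ε / 4 * Fintype.card X)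
    (hP₀ : ε * Fintype.card X < Fintype.card X - P₀)
    (hP : (P : ℝ) - P₀ < ε / 2 * (Fintype.card X - P₀)) :
    ∃ c, GoodAt σ L c ∧ ((T.filter fun t => σ t c ∈ A).card : ℝ) ≤ ε * T.card := by
  classical
  by_contra! hcon
  set N : ℝ := (Fintype.card X : ℝ) with hN
  set bad := Finset.univ.filter fun x => ¬ GoodAt σ L x
  have hTpos : (0 : ℝ) < T.card := by exact_mod_cast hT.card_pos
  have hcount : N - P₀ - ε / 4 * N ≤ (((A₀ᶜ) \ bad).card : ℝ) := by
    have h1 : (A₀ᶜ).card ≤ ((A₀ᶜ) \ bad).card + bad.card := by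
      have := Finset.le_card_sdiff bad (A₀ᶜ)
      omega
    have h2 : (A₀ᶜ).card + A₀.card = Fintype.card X := by
      rw [Finset.card_compl]
      have := Finset.card_le_univ A₀
      omega
    have h1' : ((A₀ᶜ).card : ℝ) ≤ ((A₀ᶜ) \ bad).card + bad.card := by exact_mod_cast h1
    have h2' : ((A₀ᶜ).card : ℝ) + A₀.card = N := by rw [hN]; exact_mod_cast h2
    have h3 : (A₀.card : ℝ) ≤ P₀ := by exact_mod_cast hA₀
    linarith
  have hlow : ε * T.card * (((A₀ᶜ) \ bad).card : ℝ) ≤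
      ∑ c ∈ (A₀ᶜ) \ bad, ((T.filter fun t => σ t c ∈ A).card : ℝ) := by
    rw [mul_comm, ← nsmul_eq_mul]
    refine Finset.card_nsmul_le_sum _ _ _ fun c hc => (hcon c ?_).le
    by_contra hb
    exact (Finset.mem_sdiff.mp hc).2 (Finset.mem_filter.mpr ⟨Finset.mem_univ _, hb⟩)
  -- Double counting: for fixed `t`, a point outside `A₀` hits `A` either by entering `A₀` or by
  -- landing in `A \ A₀`.
  have hup : ∑ c ∈ (A₀ᶜ) \ bad, (T.filter fun t => σ t c ∈ A).card ≤
      ∑ t ∈ T, ((A₀.filter fun x => σ t x ∉ A₀).card + (A \ A₀).card) := by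
    have h1 := Finset.sum_card_bipartiteAbove_eq_sum_card_bipartiteBelow
      (s := (A₀ᶜ) \ bad) (t := T) (fun c t => σ t c ∈ A)
    simp only [Finset.bipartiteAbove, Finset.bipartiteBelow] at h1
    rw [h1]
    refine Finset.sum_le_sum fun t _ => ?_
    have h2 : (((A₀ᶜ) \ bad).filter fun c => σ t c ∈ A) ⊆
        ((A₀ᶜ).filter fun c => σ t c ∈ A₀) ∪ (Finset.univ.filter fun c => σ t c ∈ A \ A₀) := by
      intro c hc
      simp only [Finset.mem_filter, Finset.mem_sdiff, Finset.mem_union, Finset.mem_univ,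
        true_and] at hc ⊢
      tauto
    have h3 : (Finset.univ.filter fun c => σ t c ∈ A \ A₀).card ≤ (A \ A₀).card :=
      Finset.card_le_card_of_injOn (σ t) (fun c hc => (Finset.mem_filter.mp hc).2)
        (σ t).injective.injOn
    -- A bijection sends as many points into the finite set `A₀` as out of it.
    have h4 : ((A₀ᶜ).filter fun c => σ t c ∈ A₀).card = (A₀.filter fun x => σ t x ∉ A₀).card := by
      have e1 := Finset.card_filter_add_card_filter_not (s := A₀) (fun c => σ t c ∈ A₀)
      have e2 : (A₀.filter fun c => σ t c ∈ A₀).card + ((A₀ᶜ).filter fun c => σ t c ∈ A₀).card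
          = A₀.card := by
        rw [← Finset.card_union_of_disjoint]
        · rw [← Finset.filter_union, Finset.union_compl]
          rw [← Finset.card_image_of_injective _ (σ t).injective]
          congr 1
          ext x
          simp only [Finset.mem_image, Finset.mem_filter, Finset.mem_univ, true_and]
          constructor
          · rintro ⟨y, hy, rfl⟩
            exact hy
          · exact fun hx => ⟨(σ t).symm x, by simpa using hx, by simp⟩
        · exact Finset.disjoint_filter_filter disjoint_compl_right
      omega
    calc _ ≤ _ := (Finset.card_le_card h2).trans (Finset.card_union_le _ _)
      _ ≤ _ := add_le_add h4.le h3
  have hup' : ∑ c ∈ (A₀ᶜ) \ bad, ((T.filter fun t => σ t c ∈ A).card : ℝ) ≤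
      T.card * (ε ^ 2 / 4 * P₀ + (P - P₀)) := by
    calc _ ≤ ∑ t ∈ T, (((A₀.filter fun x => σ t x ∉ A₀).card : ℝ) + (A \ A₀).card) := by
          exact_mod_cast hup
      _ ≤ ∑ t ∈ T, (ε ^ 2 / 4 * P₀ + (P - P₀)) :=
          Finset.sum_le_sum fun t ht => add_le_add (hinv t ht) hAA
      _ = _ := by rw [Finset.sum_const, nsmul_eq_mul]
  have h1 : T.card * (ε * (((A₀ᶜ) \ bad).card : ℝ)) ≤
      T.card * (ε ^ 2 / 4 * P₀ + (P - P₀)) := by linarith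
  have h2 := le_of_mul_le_mul_left h1 hTpos
  have h3 : ε * (N - P₀ - ε / 4 * N) ≤ ε * (((A₀ᶜ) \ bad).card : ℝ) := by gcongr
  have hN0 : 0 ≤ N := by positivity
  have h4 : ε ^ 2 / 4 * P₀ ≤ ε ^ 2 / 4 * N := by
    gcongr
    nlinarith
  -- The bounds combine to `ε (N - P₀ - ε N / 4) < ε² N / 4 + ε (N - P₀) / 2`, that is `N - P₀ < ε
  -- N`, against `hP₀`.
  nlinarith [mul_pos hε (sub_pos.mpr hP₀)]

-- One layer: tiles of a single shape `T` are added until an `ε / 2` fraction of the nominally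
-- uncovered part is used. Centres are sought relative to the fixed base `A₀`, `B₀`, whose
-- `T`-invariance is known; the current layer enters only through its size.
open Classical in
theorem TileMatching.exists_extension {Γ X : Type*} [Group Γ] [Fintype X]
    {σ τ : Γ → Equiv.Perm X} {F : Finset Γ} {ε : ℝ} (hε : 0 < ε) {K : Finset Γ} {η : ℝ}
    {T : Finset Γ} (hT : T.Nonempty)
    (hTK : ∀ g ∈ K, ((T.filter fun t => g * t ∉ T).card : ℝ) ≤ η * T.card)
    (hTF : ∀ g ∈ F, ((T.filter fun t => g * t ∉ T).card : ℝ) ≤ ε * T.card)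
    (hσ : ((Finset.univ.filter fun x => ¬ GoodAt σ (T ∪ (K ∪ F)) x).card : ℝ)
      ≤ ε / 4 * Fintype.card X)
    (hτ : ((Finset.univ.filter fun x => ¬ GoodAt τ (T ∪ (K ∪ F)) x).card : ℝ)
      ≤ ε / 4 * Fintype.card X)
    {A₀ B₀ : Finset X} {E₀ : Finset (X × X)} {P₀ : ℕ}
    (h₀ : TileMatching σ τ F ε (K ∪ T) (min η (ε ^ 2 / 4)) A₀ B₀ E₀ P₀)
    (hP₀ : ε * Fintype.card X < Fintype.card X - P₀) :
    ∃ A B E P, TileMatching σ τ F ε K η A B E P ∧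
      ε / 2 * (Fintype.card X - P₀) ≤ (P : ℝ) - P₀ := by
  have hT' := h₀.mono (Finset.subset_union_right (s₁ := K)) (min_le_right η (ε ^ 2 / 4))
  -- Here `m` is fuel: each added tile raises `P` by `|T| ≥ 1`, so the target is reached after
  -- finitely many tiles.
  have key : ∀ m : ℕ, ∃ A B E P, TileMatching σ τ F ε K η A B E P ∧
      ((A \ A₀).card : ℝ) ≤ P - P₀ ∧ ((B \ B₀).card : ℝ) ≤ P - P₀ ∧
      ((m : ℝ) ≤ (P : ℝ) - P₀ ∨ ε / 2 * (Fintype.card X - P₀) ≤ (P : ℝ) - P₀) := by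
    intro m
    induction m with
    | zero =>
      exact ⟨A₀, B₀, E₀, P₀, h₀.mono Finset.subset_union_left (min_le_left _ _), by simp, by simp,
        by simp⟩
    | succ m ih =>
      obtain ⟨A, B, E, P, h, hA, hB, hm⟩ := ih
      by_cases hP : ε / 2 * (Fintype.card X - P₀) ≤ (P : ℝ) - P₀
      · exact ⟨A, B, E, P, h, hA, hB, Or.inr hP⟩
      have hm := hm.resolve_right hP
      rw [not_le] at hP
      obtain ⟨c, hc, hcA⟩ := exists_center hε hT h₀.card_left hA hT'.inv_left hσ hP₀ hP
      obtain ⟨d, hd, hdB⟩ := exists_center hε hT h₀.card_right hB hT'.inv_right hτ hP₀ hP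
      have hcard : ∀ (S S₀ : Finset X) (f : Γ → X), ((S \ S₀).card : ℝ) ≤ P - P₀ →
          (((S ∪ T.image f) \ S₀).card : ℝ) ≤ (P + T.card : ℕ) - P₀ := by
        intro S S₀ f hS
        have hsub : (S ∪ T.image f) \ S₀ ⊆ (S \ S₀) ∪ T.image f := by
          intro x hx
          simp only [Finset.mem_sdiff, Finset.mem_union] at hx ⊢
          tauto
        have h1 := Nat.cast_le (α := ℝ).mpr ((Finset.card_le_card hsub).trans
          ((Finset.card_union_le _ _).trans (add_le_add_right Finset.card_image_le _)))
        push_cast at h1 ⊢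
        linarith
      refine ⟨_, _, _, _, h.addTile hTK hTF hc hd hcA hdB, hcard _ _ _ hA, hcard _ _ _ hB,
        Or.inl ?_⟩
      have : (1 : ℝ) ≤ T.card := by exact_mod_cast hT.card_pos
      push_cast
      linarith
  obtain ⟨m, hm⟩ := exists_nat_ge (ε / 2 * (Fintype.card X - P₀ : ℝ))
  obtain ⟨A, B, E, P, h, -, -, hP⟩ := key m
  exact ⟨A, B, E, P, h, hP.elim (fun h => hm.trans h) id⟩

/-! ### Almost conjugating free approximations of an amenable group -/

open Classical in
/-- Along the filter, the maps `σ k` become multiplicative and free at almost all points. -/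
def IsFreeApprox {Γ : Type*} [Group Γ] (𝓕 : Filter ℕ) {n : ℕ → ℕ}
    (σ : ∀ k, Γ → Equiv.Perm (Fin (n k))) : Prop :=
  ∀ (L : Finset Γ) (δ : ℝ), 0 < δ → ∀ᶠ k in 𝓕,
    ((Finset.univ.filter fun x => ¬ GoodAt (σ k) L x).card : ℝ) ≤ δ * n k

/-- The quantifiers over `K` and `η` sit inside the induction because the last tile shape `T` is
chosen first: the earlier layers must then be made invariant under `T` as well. Each layer
multiplies the uncovered part by at most `1 - ε / 2` unless it is already below the fraction `ε`. -/
theorem IsFreeApprox.eventually_exists_tileMatching {Γ : Type*} [Group Γ] (hΓ : IsAmenable Γ)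
    {𝓕 : Filter ℕ} {n : ℕ → ℕ} {σ τ : ∀ k, Γ → Equiv.Perm (Fin (n k))}
    (hσ : IsFreeApprox 𝓕 σ) (hτ : IsFreeApprox 𝓕 τ) (F : Finset Γ) {ε : ℝ} (hε : 0 < ε)
    (hε1 : ε ≤ 1) (l : ℕ) : ∀ (K : Finset Γ) (η : ℝ), 0 < η → ∀ᶠ k in 𝓕,
      ∃ A B E P, TileMatching (σ k) (τ k) F ε K η A B E P ∧
        (n k : ℝ) - P ≤ max ε ((1 - ε / 2) ^ l) * n k := by
  classical
  induction l with
  | zero =>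
    intro K η hη
    refine Eventually.of_forall fun k => ⟨∅, ∅, ∅, 0, TileMatching.empty _ _ _ _ _ _, ?_⟩
    simp [hε1]
  | succ l ih =>
    intro K η hη
    obtain ⟨T, hT, hTinv⟩ := isAmenable_iff.mp hΓ (K ∪ F) (min η ε) (lt_min hη hε)
    have hTK : ∀ g ∈ K, ((T.filter fun t => g * t ∉ T).card : ℝ) ≤ η * T.card := fun g hg => by
      have := hTinv g (Finset.mem_union_left _ hg)
      refine le_trans (le_of_eq ?_) (this.trans ?_)
      · congr!
      · gcongr
        exact min_le_left _ _
    have hTF : ∀ g ∈ F, ((T.filter fun t => g * t ∉ T).card : ℝ) ≤ ε * T.card := fun g hg => by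
      have := hTinv g (Finset.mem_union_right _ hg)
      refine le_trans (le_of_eq ?_) (this.trans ?_)
      · congr!
      · gcongr
        exact min_le_right _ _
    filter_upwards [ih (K ∪ T) (min η (ε ^ 2 / 4)) (lt_min hη (by positivity)),
      hσ (T ∪ (K ∪ F)) (ε / 4) (by positivity), hτ (T ∪ (K ∪ F)) (ε / 4) (by positivity)]
      with k ⟨A₀, B₀, E₀, P₀, h₀, hP₀⟩ hσk hτk
    by_cases hlt : ε * n k < n k - P₀
    · obtain ⟨A, B, E, P, h, hP⟩ := TileMatching.exists_extension hε hT
        (by convert hTK) (by convert hTF) (by simpa using hσk) (by simpa using hτk)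
        h₀ (by simpa using hlt)
      refine ⟨A, B, E, P, h, ?_⟩
      rw [Fintype.card_fin] at hP
      have hn : (0 : ℝ) ≤ n k := by positivity
      have h1 : (n k : ℝ) - P₀ ≤ (1 - ε / 2) ^ l * n k := by
        rw [max_mul_of_nonneg _ _ hn] at hP₀
        exact (le_max_iff.mp hP₀).resolve_left (not_le.mpr hlt)
      have h2 : (1 - ε / 2) * ((n k : ℝ) - P₀) ≤ (1 - ε / 2) * ((1 - ε / 2) ^ l * n k) :=
        mul_le_mul_of_nonneg_left h1 (by linarith)
      calc (n k : ℝ) - P ≤ (1 - ε / 2) * ((n k : ℝ) - P₀) := by linarith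
        _ ≤ (1 - ε / 2) ^ (l + 1) * n k := by rw [pow_succ]; linarith
        _ ≤ _ := by
          gcongr
          exact le_max_right _ _
    · refine ⟨A₀, B₀, E₀, P₀, h₀.mono Finset.subset_union_left (min_le_left _ _), ?_⟩
      rw [not_lt] at hlt
      refine hlt.trans ?_
      gcongr
      exact le_max_left _ _

theorem exists_perm_extending {X : Type*} [Fintype X] {E : Finset (X × X)}
    (h1 : Set.InjOn Prod.fst (E : Set (X × X))) (h2 : Set.InjOn Prod.snd (E : Set (X × X))) :
    ∃ s : Equiv.Perm X, ∀ p ∈ E, s p.1 = p.2 := by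
  classical
  have hex : ∀ x : X, ∃ y, ∀ p ∈ E, p.1 = x → p.2 = y := by
    intro x
    by_cases h : ∃ p ∈ E, p.1 = x
    · obtain ⟨p, hp, rfl⟩ := h
      exact ⟨p.2, fun q hq hqp => by rw [h1 hq hp hqp]⟩
    · exact ⟨x, fun p hp hpx => (h ⟨p, hp, hpx⟩).elim⟩
  choose f hf using hex
  have hinj : Set.InjOn f (E.image Prod.fst : Finset X) := by
    intro x hx y hy hxy
    simp only [Finset.coe_image, Set.mem_image, Finset.mem_coe] at hx hy
    obtain ⟨p, hp, rfl⟩ := hx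
    obtain ⟨q, hq, rfl⟩ := hy
    rw [← hf _ p hp rfl, ← hf _ q hq rfl] at hxy
    rw [h2 hp hq hxy]
  obtain ⟨g, hg⟩ := Finset.exists_equiv_extend_of_card_eq (t := (Finset.univ : Finset X))
    (by simp) (Finset.subset_univ _) hinj
  refine ⟨g.trans (Equiv.subtypeUnivEquiv (by simp)), fun p hp => ?_⟩
  rw [hf _ p hp rfl, ← hg p.1 (Finset.mem_image_of_mem _ hp)]
  rfl

theorem IsFreeApprox.eventually_exists_conj {Γ : Type*} [Group Γ] (hΓ : IsAmenable Γ)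
    {𝓕 : Filter ℕ} {n : ℕ → ℕ} (hn : ∀ k, 0 < n k) {σ τ : ∀ k, Γ → Equiv.Perm (Fin (n k))}
    (hσ : IsFreeApprox 𝓕 σ) (hτ : IsFreeApprox 𝓕 τ) (F : Finset Γ) {ε : ℝ} (hε : 0 < ε) :
    ∀ᶠ k in 𝓕, ∃ s : Equiv.Perm (Fin (n k)), ∀ g ∈ F,
      normHamming (τ k g * s) (s * σ k g) ≤ ε := by
  classical
  wlog hε1 : ε ≤ 1 generalizing ε
  · filter_upwards [this one_pos le_rfl] with k ⟨s, hs⟩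
    exact ⟨s, fun g hg => (hs g hg).trans (not_le.mp hε1).le⟩
  -- Unmatched points cost at most `3 ε' n`; non-equivariant pairs cost `3 ε' P ≤ 6 ε' n`, since `P
  -- ≤ 2 n`.
  set ε' := ε / 9 with hε'
  obtain ⟨l, hl⟩ := exists_pow_lt_of_lt_one (x := ε') (y := 1 - ε' / 2) (by positivity)
    (by linarith)
  filter_upwards [hσ.eventually_exists_tileMatching hΓ hτ F (ε := ε') (by positivity)
    (by linarith) l ∅ 1 one_pos] with k ⟨A, B, E, P, h, hP⟩
  rw [max_eq_left hl.le] at hP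
  obtain ⟨s, hs⟩ := exists_perm_extending h.fst_inj h.snd_inj
  refine ⟨s, fun g hg => normHamming_le_of_card_ne_le (hn k) ?_⟩
  have hsub : (Finset.univ.filter fun x => (τ k g * s) x ≠ (s * σ k g) x) ⊆
      (E.image Prod.fst)ᶜ ∪ (E.filter fun p => (σ k g p.1, τ k g p.2) ∉ E).image Prod.fst := by
    intro x hx
    have hx := (Finset.mem_filter.mp hx).2
    rw [Equiv.Perm.mul_apply, Equiv.Perm.mul_apply] at hx
    rw [Finset.mem_union, Finset.mem_compl]
    by_cases hxE : x ∈ E.image Prod.fst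
    · right
      obtain ⟨p, hp, rfl⟩ := Finset.mem_image.mp hxE
      refine Finset.mem_image_of_mem _ (Finset.mem_filter.mpr ⟨hp, fun hp' => hx ?_⟩)
      rw [hs p hp, hs _ hp']
    · exact Or.inl hxE
  have h1 : ((Finset.univ.filter fun x => (τ k g * s) x ≠ (s * σ k g) x).card : ℝ) ≤ _ :=
    Nat.cast_le.mpr ((Finset.card_le_card hsub).trans
      ((Finset.card_union_le _ _).trans (add_le_add_right Finset.card_image_le _)))
  have h2 : (((E.image Prod.fst)ᶜ).card : ℝ) + E.card = n k := by
    have := Finset.card_add_card_compl (E.image Prod.fst)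
    rw [Finset.card_image_of_injOn h.fst_inj, Fintype.card_fin] at this
    rw [add_comm]
    exact_mod_cast this
  have h3 : ((E.filter fun p => (σ k g p.1, τ k g p.2) ∉ E).card : ℝ) ≤ 3 * ε' * P := by
    convert h.equivariant g hg
  have h4 := h.le_card
  have h5 : (E.card : ℝ) ≤ n k := by linarith [Nat.cast_nonneg (α := ℝ) ((E.image Prod.fst)ᶜ).card]
  have hP0 : (0 : ℝ) ≤ P := Nat.cast_nonneg P
  have h6 : (P : ℝ) ≤ 2 * n k := by nlinarith
  have hε0 : 0 < ε' := by positivity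
  have h7 := mul_le_mul_of_nonneg_left h6 hε0.le
  rw [Nat.cast_add] at h1
  have h8 : ε = 9 * ε' := by rw [hε']; ring
  have h9 : (1 - 2 * ε') * ((1 - ε') * n k) ≤ (1 - 2 * ε') * P :=
    mul_le_mul_of_nonneg_left (by linarith) (by linarith)
  have h10 : 0 ≤ ε' ^ 2 * (n k : ℝ) := by positivity
  rw [h8]
  nlinarith

/-! ### Passage to the ultraproduct -/

theorem normHamming_inv_mul {n : ℕ} (σ τ : Equiv.Perm (Fin n)) :
    normHamming (σ⁻¹ * τ) 1 = normHamming σ τ := by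
  rw [← normHamming_mul_left σ, mul_inv_cancel_left, mul_one, normHamming_comm]

theorem mk_eq_mk_iff {𝒰 : Ultrafilter ℕ} {n : ℕ → ℕ} {σ τ : ∀ k, Equiv.Perm (Fin (n k))} :
    (QuotientGroup.mk σ : UniversalSoficGroup 𝒰 n) = QuotientGroup.mk τ ↔
      Tendsto (fun k => normHamming (σ k) (τ k)) (𝒰 : Filter ℕ) (𝓝 0) := by
  rw [QuotientGroup.eq]
  change Tendsto (fun k => normHamming ((σ k)⁻¹ * τ k) 1) _ _ ↔ _
  simp only [normHamming_inv_mul]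

theorem isFreeApprox_of_tendsto {Γ : Type*} [Group Γ] {𝓕 : Filter ℕ} {n : ℕ → ℕ}
    {σ : ∀ k, Γ → Equiv.Perm (Fin (n k))}
    (hm : ∀ g h, Tendsto (fun k => normHamming (σ k (g * h)) (σ k g * σ k h)) 𝓕 (𝓝 0))
    (hf : ∀ g h, g ≠ h → Tendsto (fun k => normHamming (σ k g) (σ k h)) 𝓕 (𝓝 1)) :
    IsFreeApprox 𝓕 σ := by
  intro L δ hδ
  obtain ⟨ε, hε, hεδ⟩ : ∃ ε : ℝ, 0 < ε ∧ 2 * (L.card : ℝ) ^ 2 * ε ≤ δ := by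
    refine ⟨δ / (2 * (L.card : ℝ) ^ 2 + 1), by positivity, ?_⟩
    rw [mul_div_assoc', div_le_iff₀ (by positivity)]
    linarith
  have h1 : ∀ᶠ k in 𝓕, ∀ g ∈ L, ∀ h ∈ L, normHamming (σ k (g * h)) (σ k g * σ k h) ≤ ε := by
    rw [eventually_all_finset]
    intro g _
    rw [eventually_all_finset]
    intro h _
    exact (hm g h).eventually_le_const hε
  have h2 : ∀ᶠ k in 𝓕, ∀ g ∈ L, ∀ h ∈ L, g ≠ h → 1 - ε ≤ normHamming (σ k g) (σ k h) := by
    rw [eventually_all_finset]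
    intro g _
    rw [eventually_all_finset]
    intro h _
    by_cases hgh : g = h
    · simp [hgh]
    · filter_upwards [(hf g h hgh).eventually_const_le (by linarith : 1 - ε < 1)] with k hk _
      exact hk
  filter_upwards [h1, h2] with k hk1 hk2
  refine (card_not_goodAt_le hk1 hk2 hε.le).trans ?_
  gcongr

theorem IsSoficRepresentation.isFreeApprox {Γ : Type*} [Group Γ] {𝒰 : Ultrafilter ℕ}
    {n : ℕ → ℕ} {π : Γ →* UniversalSoficGroup 𝒰 n} (hπ : IsSoficRepresentation π)
    {σ : ∀ k, Γ → Equiv.Perm (Fin (n k))}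
    (hσ : ∀ g, (QuotientGroup.mk (fun k => σ k g) : UniversalSoficGroup 𝒰 n) = π g) :
    IsFreeApprox (𝒰 : Filter ℕ) σ := by
  refine isFreeApprox_of_tendsto (fun g h => ?_) (fun g h hgh => ?_)
  · have : (QuotientGroup.mk (fun k => σ k (g * h)) : UniversalSoficGroup 𝒰 n) =
        QuotientGroup.mk ((fun k => σ k g) * fun k => σ k h) := by
      rw [QuotientGroup.mk_mul, hσ, hσ, hσ, map_mul]
    exact mk_eq_mk_iff.mp this
  · have h1 := hπ.2 (g⁻¹ * h) (by rwa [ne_eq, inv_mul_eq_one])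
      ((fun k => σ k g)⁻¹ * fun k => σ k h)
      (by rw [QuotientGroup.mk_mul, QuotientGroup.mk_inv, hσ, hσ, map_mul, map_inv])
    exact h1.congr fun k => normHamming_inv_mul _ _

/-- A diagonal argument: nested conditions, each eventually satisfiable, are satisfied by a single
sequence. -/
theorem exists_diagonal {𝓕 : Filter ℕ} (h𝓕 : 𝓕 ≤ cofinite) {S : ℕ → Type*}
    [∀ k, Nonempty (S k)] {Q : ℕ → ∀ k, S k → Prop}
    (hanti : ∀ i j, i ≤ j → ∀ k s, Q j k s → Q i k s)
    (hev : ∀ j, ∀ᶠ k in 𝓕, ∃ s, Q j k s) :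
    ∃ s : ∀ k, S k, ∀ j, ∀ᶠ k in 𝓕, Q j k (s k) := by
  classical
  -- At stage `k`, satisfy the strongest satisfiable condition of index at most `k`; it implies all
  -- weaker ones.
  have hex : ∀ k, ∃ s, ∀ j ≤ k, (∃ s', Q j k s') → Q j k s := by
    intro k
    by_cases h : ∃ s, Q (Nat.findGreatest (fun j => ∃ s', Q j k s') k) k s
    · obtain ⟨s, hs⟩ := h
      exact ⟨s, fun j hj hj' => hanti _ _ (Nat.le_findGreatest hj hj') _ _ hs⟩
    · exact ⟨Classical.arbitrary _, fun j hj hj' =>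
        (h (Nat.findGreatest_spec (P := fun j => ∃ s', Q j k s') hj hj')).elim⟩
  choose s hs using hex
  refine ⟨s, fun j => ?_⟩
  have hj : ∀ᶠ k in 𝓕, j ≤ k := by
    rw [Nat.cofinite_eq_atTop] at h𝓕
    exact h𝓕 (eventually_ge_atTop j)
  filter_upwards [hev j, hj] with k hk hjk
  exact hs k j hjk hk

theorem exists_exhausting_finsets (Γ : Type*) [Countable Γ] :
    ∃ Φ : ℕ → Finset Γ, Monotone Φ ∧ ∀ g, ∃ j, g ∈ Φ j := by
  obtain ⟨f, hf⟩ := Countable.exists_injective_nat Γ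
  have hfin : ∀ j, (f ⁻¹' Set.Iic j).Finite := fun j => (Set.finite_Iic j).preimage hf.injOn
  refine ⟨fun j => (hfin j).toFinset, fun i j hij g hg => ?_, fun g => ⟨f g, by simp⟩⟩
  simp only [Set.Finite.mem_toFinset, Set.mem_preimage, Set.mem_Iic] at hg ⊢
  exact hg.trans hij

theorem tendsto_zero_of_eventually_le {𝓕 : Filter ℕ} {u : ℕ → ℝ} (h0 : ∀ k, 0 ≤ u k) {i : ℕ}
    (h : ∀ j, i ≤ j → ∀ᶠ k in 𝓕, u k ≤ 1 / ((j : ℝ) + 1)) : Tendsto u 𝓕 (𝓝 0) := by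
  rw [tendsto_order]
  refine ⟨fun a ha => Eventually.of_forall fun k => ha.trans_le (h0 k), fun a ha => ?_⟩
  obtain ⟨N, hN⟩ := exists_nat_one_div_lt ha
  filter_upwards [h (max i N) (le_max_left _ _)] with k hk
  refine hk.trans_lt (lt_of_le_of_lt ?_ hN)
  have : (N : ℝ) ≤ (max i N : ℕ) := by exact_mod_cast le_max_right i N
  gcongr

theorem areConjugate_of_isAmenable {Γ : Type*} [Group Γ] [Countable Γ] (hΓ : IsAmenable Γ)
    {𝒰 : Ultrafilter ℕ} (h𝒰 : (𝒰 : Filter ℕ) ≤ cofinite) {n : ℕ → ℕ} (hn : ∀ k, 0 < n k)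
    {π₁ π₂ : Γ →* UniversalSoficGroup 𝒰 n} (h₁ : IsSoficRepresentation π₁)
    (h₂ : IsSoficRepresentation π₂) : AreConjugate π₁ π₂ := by
  choose σ hσ using fun g => QuotientGroup.mk_surjective (π₁ g)
  choose τ hτ using fun g => QuotientGroup.mk_surjective (π₂ g)
  have hσ' := h₁.isFreeApprox (σ := fun k g => σ g k) hσ
  have hτ' := h₂.isFreeApprox (σ := fun k g => τ g k) hτ
  obtain ⟨Φ, hΦ, hΦ'⟩ := exists_exhausting_finsets Γ
  obtain ⟨s, hs⟩ := exists_diagonal h𝒰 (S := fun k => Equiv.Perm (Fin (n k)))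
    (Q := fun j k s => ∀ g ∈ Φ j, normHamming (τ g k * s) (s * σ g k) ≤ 1 / ((j : ℝ) + 1))
    (fun i j hij k s h g hg => (h g (hΦ hij hg)).trans (by gcongr))
    (fun j => hσ'.eventually_exists_conj hΓ hn hτ' (Φ j) (by positivity))
  refine ⟨QuotientGroup.mk s, fun g => ?_⟩
  rw [eq_mul_inv_iff_mul_eq, ← hσ, ← hτ, ← QuotientGroup.mk_mul, ← QuotientGroup.mk_mul,
    mk_eq_mk_iff]
  obtain ⟨i, hi⟩ := hΦ' g
  refine tendsto_zero_of_eventually_le (i := i) (fun k => normHamming_nonneg _ _) fun j hij => ?_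
  filter_upwards [hs j] with k hk
  exact hk g (hΦ hij hi)

/-! ### Sofic representations built from approximations -/

/-- The homomorphism into the universal sofic group given by asymptotically multiplicative maps. -/
def homOfApprox {Γ : Type*} [Group Γ] {𝒰 : Ultrafilter ℕ} {n : ℕ → ℕ}
    (σ : ∀ k, Γ → Equiv.Perm (Fin (n k)))
    (hm : ∀ g h, Tendsto (fun k => normHamming (σ k (g * h)) (σ k g * σ k h))
      (𝒰 : Filter ℕ) (𝓝 0)) : Γ →* UniversalSoficGroup 𝒰 n :=
  MonoidHom.mk' (fun g => QuotientGroup.mk fun k => σ k g) fun g h => by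
    rw [← QuotientGroup.mk_mul]
    exact mk_eq_mk_iff.mpr (hm g h)

theorem isSoficRepresentation_homOfApprox {Γ : Type*} [Group Γ] {𝒰 : Ultrafilter ℕ} {n : ℕ → ℕ}
    (σ : ∀ k, Γ → Equiv.Perm (Fin (n k)))
    (hm : ∀ g h, Tendsto (fun k => normHamming (σ k (g * h)) (σ k g * σ k h))
      (𝒰 : Filter ℕ) (𝓝 0))
    (hf : ∀ g, g ≠ 1 → Tendsto (fun k => normHamming (σ k g) 1) (𝒰 : Filter ℕ) (𝓝 1)) :
    IsSoficRepresentation (homOfApprox σ hm) := by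
  have key : ∀ g : Γ, g ≠ 1 → ∀ ρ : ∀ k, Equiv.Perm (Fin (n k)),
      (QuotientGroup.mk ρ : UniversalSoficGroup 𝒰 n) = homOfApprox σ hm g →
        Tendsto (fun k => normHamming (ρ k) 1) (𝒰 : Filter ℕ) (𝓝 1) := by
    intro g hg ρ hρ
    have h1 : Tendsto (fun k => normHamming (ρ k) (σ k g)) (𝒰 : Filter ℕ) (𝓝 0) :=
      mk_eq_mk_iff.mp hρ
    have h2 := (hf g hg).sub h1
    rw [sub_zero] at h2
    refine tendsto_of_tendsto_of_tendsto_of_le_of_le h2 tendsto_const_nhds (fun k => ?_)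
      (fun k => normHamming_le_one _ _)
    have := normHamming_triangle (σ k g) (ρ k) 1
    rw [normHamming_comm (σ k g) (ρ k)] at this
    dsimp only
    linarith
  refine ⟨(injective_iff_map_eq_one _).mpr fun g hg => ?_, key⟩
  by_contra hne
  have h1 := key g hne 1 (by rw [hg, QuotientGroup.mk_one])
  simp only [Pi.one_apply, normHamming_self] at h1
  exact zero_ne_one (tendsto_nhds_unique tendsto_const_nhds h1)

/-- Resetting the value at `1` is cheap because `ψ 1 ψ 1 ≈ ψ 1` forces `ψ 1 ≈ 1`. Pairwise
separation follows by multiplying by `φ h⁻¹` on the left, which compares `φ g`, `φ h` with `φ (h⁻¹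
g)`, `1`. -/
theorem IsSofic.exists_approx {Γ : Type*} [Group Γ] (hΓ : IsSofic Γ) (F : Finset Γ) {ε : ℝ}
    (hε : 0 < ε) : ∃ (n : ℕ) (φ : Γ → Equiv.Perm (Fin n)), 0 < n ∧ φ 1 = 1 ∧
      (∀ g ∈ F, ∀ h ∈ F, normHamming (φ (g * h)) (φ g * φ h) ≤ ε) ∧
      (∀ g ∈ F, ∀ h ∈ F, g ≠ h → 1 - ε ≤ normHamming (φ g) (φ h)) := by
  classical
  set M := insert 1 (F ∪ F⁻¹) with hM
  have hM1 : (1 : Γ) ∈ M := Finset.mem_insert_self _ _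
  have hFM : ∀ g ∈ F, g ∈ M := fun g hg => by simp [hM, hg]
  have hFM' : ∀ g ∈ F, g⁻¹ ∈ M := fun g hg => by simp [hM, hg]
  have hMM : ∀ g ∈ M, g ∈ M * M := fun g hg => by
    simpa using Finset.mul_mem_mul hg hM1
  obtain ⟨n, ψ, hn, hm, hf⟩ := hΓ (M * M) (ε / 6) (by positivity)
  have h1 : normHamming (ψ 1) 1 ≤ ε / 6 := by
    have := hm 1 (hMM 1 hM1) 1 (hMM 1 hM1)
    rw [one_mul] at this
    rw [← normHamming_mul_left (ψ 1), mul_one, normHamming_comm]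
    exact this
  set φ := Function.update ψ 1 1 with hφ
  have hφ1 : φ 1 = 1 := by simp [hφ]
  have hφn : ∀ g, g ≠ 1 → φ g = ψ g := fun g hg => by simp [hφ, hg]
  have hmul : ∀ g ∈ M, ∀ h ∈ M, normHamming (φ (g * h)) (φ g * φ h) ≤ ε / 3 := by
    intro g hg h hh
    by_cases hg1 : g = 1
    · rw [hg1, one_mul, hφ1, one_mul, normHamming_self]
      positivity
    by_cases hh1 : h = 1
    · rw [hh1, mul_one, hφ1, mul_one, normHamming_self]
      positivity
    rw [hφn g hg1, hφn h hh1]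
    have h2 := hm g (hMM g hg) h (hMM h hh)
    by_cases hgh : g * h = 1
    · rw [hgh, hφ1]
      rw [hgh] at h2
      have := normHamming_triangle 1 (ψ 1) (ψ g * ψ h)
      rw [normHamming_comm 1 (ψ 1)] at this
      linarith
    · rw [hφn _ hgh]
      linarith
  refine ⟨n, φ, hn, hφ1, fun g hg h hh => (hmul g (hFM g hg) h (hFM h hh)).trans (by linarith),
    fun g hg h hh hgh => ?_⟩
  have hne : h⁻¹ * g ≠ 1 := by
    rw [ne_eq, inv_mul_eq_one]
    exact fun h => hgh h.symm
  have h2 := hf (h⁻¹ * g) (Finset.mul_mem_mul (hFM' h hh) (hFM g hg)) hne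
  rw [← hφn _ hne] at h2
  have h3 := hmul h⁻¹ (hFM' h hh) g (hFM g hg)
  have h4 := hmul h⁻¹ (hFM' h hh) h (hFM h hh)
  rw [inv_mul_cancel, hφ1, normHamming_comm] at h4
  have h5 := normHamming_mul_left (φ h⁻¹) (φ g) (φ h)
  have h6 := normHamming_triangle (φ (h⁻¹ * g)) (φ h⁻¹ * φ g) 1
  have h7 := normHamming_triangle (φ h⁻¹ * φ g) (φ h⁻¹ * φ h) 1
  linarith

/-! ### Transfer of expansion from the group to good points -/

open Classical in
/-- If small finite sets of group elements have large boundary under `F`, so do small finite sets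
of good points. -/
theorem exists_reach {Γ X : Type*} [Group Γ] {σ : Γ → Equiv.Perm X} {F : Finset Γ} {η : ℝ}
    (hexp : ∀ T : Finset Γ, T.Nonempty → ∃ g ∈ F,
      η * T.card < ((T.filter fun t => g * t ∉ T).card : ℝ))
    {N : ℕ} {P : Finset X} (hPN : P.card ≤ N) {x₀ : X} (hx₀ : x₀ ∈ P)
    (hgood : GoodAt σ ((insert 1 F) ^ (N + 1)) x₀) :
    ∃ Q ⊆ P, Q.Nonempty ∧ (∀ g ∈ F, ∀ x ∈ Q, σ g x ∈ P → σ g x ∈ Q) ∧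
      ∃ g ∈ F, η * Q.card < ((Q.filter fun x => σ g x ∉ Q).card : ℝ) := by
  set S := insert 1 F with hS
  have hS1 : (1 : Γ) ∈ S := Finset.mem_insert_self _ _
  have hN : 0 < N := (Finset.card_pos.mpr ⟨x₀, hx₀⟩).trans_le hPN
  have hpow : ∀ i j, i ≤ j → S ^ i ⊆ S ^ j := fun i j hij => Finset.pow_subset_pow_right hS1 hij
  -- The condition `A ⊆ S ^ A.card` replaces connectedness: as `|A| ≤ |P| ≤ N`, adding one element
  -- `g * a` stays within the radius where `x₀` is good. A largest candidate is therefore closed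
  -- under steps of `F` inside `P`.
  set cand := ((S ^ N).powerset.filter fun A => 1 ∈ A ∧ A ⊆ S ^ A.card ∧ ∀ a ∈ A, σ a x₀ ∈ P)
    with hcand
  have h1S : (1 : Γ) ∈ S ^ (N + 1) := Finset.one_mem_pow hS1
  have hone : σ 1 x₀ = x₀ := hgood.map_one h1S
  have hne : cand.Nonempty := by
    refine ⟨{1}, ?_⟩
    simp only [hcand, Finset.mem_filter, Finset.mem_powerset, Finset.singleton_subset_iff,
      Finset.mem_singleton, Finset.card_singleton, pow_one, forall_eq, hone]
    exact ⟨Finset.one_mem_pow hS1, trivial, hS1, hx₀⟩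
  obtain ⟨A, hA, hmax⟩ := Finset.exists_max_image cand Finset.card hne
  simp only [hcand, Finset.mem_filter, Finset.mem_powerset] at hA hmax
  obtain ⟨hAN, hA1, hAS, hAP⟩ := hA
  have hinj : Set.InjOn (fun g => σ g x₀) (S ^ (N + 1) : Finset Γ) := hgood.2
  have hAN' : ∀ a ∈ A, a ∈ S ^ (N + 1) := fun a ha => hpow N (N + 1) (by omega) (hAN ha)
  have hFS : ∀ g ∈ F, g ∈ S ^ (N + 1) := fun g hg =>
    hpow 1 (N + 1) (by omega) (by rw [pow_one]; exact Finset.mem_insert_of_mem hg)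
  have hmul : ∀ g ∈ F, ∀ a ∈ A, g * a ∈ S ^ (N + 1) := fun g hg a ha => by
    rw [pow_succ']
    exact Finset.mul_mem_mul (Finset.mem_insert_of_mem hg) (hAN ha)
  have hact : ∀ g ∈ F, ∀ a ∈ A, σ (g * a) x₀ = σ g (σ a x₀) := fun g hg a ha =>
    hgood.1 g (hFS g hg) a (hAN' a ha)
  have hclosed : ∀ g ∈ F, ∀ a ∈ A, σ g (σ a x₀) ∈ P → g * a ∈ A := by
    intro g hg a ha hP
    by_contra hga
    have hsub : ∀ b ∈ insert (g * a) A, b ∈ S ^ (N + 1) := by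
      intro b hb
      obtain rfl | hb := Finset.mem_insert.mp hb
      · exact hmul g hg a ha
      · exact hAN' b hb
    have hmaps : ∀ b ∈ insert (g * a) A, σ b x₀ ∈ P := by
      intro b hb
      obtain rfl | hb := Finset.mem_insert.mp hb
      · rw [hact g hg a ha]
        exact hP
      · exact hAP b hb
    have hcard : (insert (g * a) A).card ≤ P.card :=
      Finset.card_le_card_of_injOn _ hmaps (hinj.mono fun b hb => hsub b hb)
    have hcard' : (insert (g * a) A).card = A.card + 1 := Finset.card_insert_of_notMem hga
    have hsub' : insert (g * a) A ⊆ S ^ (insert (g * a) A).card := by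
      intro b hb
      rw [hcard']
      obtain rfl | hb := Finset.mem_insert.mp hb
      · rw [pow_succ']
        exact Finset.mul_mem_mul (Finset.mem_insert_of_mem hg) (hAS ha)
      · exact hpow _ _ (Nat.le_succ _) (hAS hb)
    have := hmax (insert (g * a) A) ⟨hsub'.trans (hpow _ _ (hcard.trans hPN)),
      Finset.mem_insert_of_mem hA1, hsub', hmaps⟩
    omega
  have hinjA : Set.InjOn (fun g => σ g x₀) (A : Set Γ) := hinj.mono fun a ha => hAN' a ha
  refine ⟨A.image fun a => σ a x₀, ?_, ⟨_, Finset.mem_image_of_mem _ hA1⟩, ?_, ?_⟩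
  · intro x hx
    obtain ⟨a, ha, rfl⟩ := Finset.mem_image.mp hx
    exact hAP a ha
  · intro g hg x hx hP
    obtain ⟨a, ha, rfl⟩ := Finset.mem_image.mp hx
    exact Finset.mem_image.mpr ⟨g * a, hclosed g hg a ha hP, hact g hg a ha⟩
  · obtain ⟨g, hg, hlt⟩ := hexp A ⟨1, hA1⟩
    refine ⟨g, hg, ?_⟩
    rw [Finset.card_image_of_injOn hinjA]
    refine hlt.trans_le (Nat.cast_le.mpr ?_)
    refine Finset.card_le_card_of_injOn (fun a => σ a x₀) (fun a ha => ?_)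
      (hinjA.mono fun a ha => (Finset.mem_filter.mp ha).1)
    obtain ⟨ha, hga⟩ := Finset.mem_filter.mp ha
    refine Finset.mem_filter.mpr ⟨Finset.mem_image_of_mem _ ha, fun h => hga ?_⟩
    obtain ⟨b, hb, hbe⟩ := Finset.mem_image.mp h
    rw [← hact g hg a ha] at hbe
    rw [← hinj (hAN' b hb) (hmul g hg a ha) hbe]
    exact hb

-- Strong induction, splitting off the reachable set `Q` of a point. As `F` is symmetric, no
-- `F`-step joins `Q` to `P \ Q` in either direction, so the two boundaries are disjoint parts of
-- the boundary of `P`.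
open Classical in
theorem card_le_boundary_of_goodAt {Γ X : Type*} [Group Γ] {σ : Γ → Equiv.Perm X} {F : Finset Γ}
    (hF : ∀ g ∈ F, g⁻¹ ∈ F) {η : ℝ}
    (hexp : ∀ T : Finset Γ, T.Nonempty → ∃ g ∈ F,
      η * T.card < ((T.filter fun t => g * t ∉ T).card : ℝ))
    {N : ℕ} (P : Finset X) (hPN : P.card ≤ N)
    (hgood : ∀ x ∈ P, GoodAt σ ((insert 1 F) ^ (N + 1)) x) :
    η * P.card ≤ ∑ g ∈ F, ((P.filter fun x => σ g x ∉ P).card : ℝ) := by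
  induction P using Finset.strongInduction with
  | H P ih =>
    obtain rfl | ⟨x₀, hx₀⟩ := P.eq_empty_or_nonempty
    · simp
    obtain ⟨Q, hQP, hQ, hclosed, g₀, hg₀, hlt⟩ := exists_reach hexp hPN hx₀ (hgood x₀ hx₀)
    have hFS : ∀ g ∈ F, g ∈ (insert 1 F) ^ (N + 1) := fun g hg =>
      Finset.pow_subset_pow_right (Finset.mem_insert_self _ _) (Nat.le_add_left 1 N)
        (by rw [pow_one]; exact Finset.mem_insert_of_mem hg)
    have hback : ∀ g ∈ F, ∀ x ∈ P, σ g x ∈ Q → x ∈ Q := by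
      intro g hg x hx hgx
      have h1 : σ g⁻¹ (σ g x) = x := by
        rw [← (hgood x hx).1 g⁻¹ (hFS _ (hF g hg)) g (hFS g hg), inv_mul_cancel]
        exact (hgood x hx).map_one (Finset.one_mem_pow (Finset.mem_insert_self _ _))
      have h2 := hclosed g⁻¹ (hF g hg) (σ g x) hgx
      rw [h1] at h2
      exact h2 hx
    have hih := ih (P \ Q) (Finset.sdiff_ssubset hQP hQ)
      ((Finset.card_le_card Finset.sdiff_subset).trans hPN)
      fun x hx => hgood x (Finset.mem_sdiff.mp hx).1
    have hQ' : η * Q.card ≤ ∑ g ∈ F, ((Q.filter fun x => σ g x ∉ Q).card : ℝ) :=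
      hlt.le.trans (Finset.single_le_sum
        (f := fun g => ((Q.filter fun x => σ g x ∉ Q).card : ℝ)) (fun g _ => by positivity) hg₀)
    have hcard : (P.card : ℝ) = (P \ Q).card + Q.card := by
      exact_mod_cast (Finset.card_sdiff_add_card_eq_card hQP).symm
    rw [hcard, mul_add]
    refine (add_le_add hih hQ').trans ?_
    rw [← Finset.sum_add_distrib]
    refine Finset.sum_le_sum fun g hg => ?_
    rw [← Nat.cast_add, ← Finset.card_union_of_disjoint
      (Finset.disjoint_filter_filter Finset.sdiff_disjoint)]
    refine Nat.cast_le.mpr (Finset.card_le_card fun x hx => ?_)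
    simp only [Finset.mem_union, Finset.mem_filter, Finset.mem_sdiff, not_and, not_not] at hx ⊢
    obtain ⟨⟨hxP, hxQ⟩, h⟩ | ⟨hxQ, h⟩ := hx
    · exact ⟨hxP, fun hgP => hxQ (hback g hg x hxP (h hgP))⟩
    · exact ⟨hQP hxQ, fun hgP => h (hclosed g hg x hxQ hgP)⟩

/-! ### Product actions -/

/-- The product action of two permutations on `Fin n × Fin m ≃ Fin (n * m)`. -/
def prodPerm {n m : ℕ} (a : Equiv.Perm (Fin n)) (b : Equiv.Perm (Fin m)) :
    Equiv.Perm (Fin (n * m)) :=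
  finProdFinEquiv.permCongr (Equiv.prodCongr a b)

theorem prodPerm_mul {n m : ℕ} (a a' : Equiv.Perm (Fin n)) (b b' : Equiv.Perm (Fin m)) :
    prodPerm (a * a') (b * b') = prodPerm a b * prodPerm a' b' := by
  ext x
  simp [prodPerm]

theorem prodPerm_one_one {n m : ℕ} :
    prodPerm (1 : Equiv.Perm (Fin n)) (1 : Equiv.Perm (Fin m)) = 1 :=
  Equiv.ext fun x => finProdFinEquiv.apply_symm_apply x

theorem normHamming_permCongr {n : ℕ} {X : Type*} [Fintype X] [DecidableEq X] (e : X ≃ Fin n)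
    (a b : Equiv.Perm X) : normHamming (e.permCongr a) (e.permCongr b) =
      ((Finset.univ.filter fun x => a x ≠ b x).card : ℝ) / n := by
  rw [normHamming_eq_card]
  congr 2
  refine Finset.card_bij' (fun x _ => e.symm x) (fun x _ => e x) ?_ ?_ ?_ ?_ <;> simp

theorem normHamming_prodPerm_le {n m : ℕ} (a a' : Equiv.Perm (Fin n)) (b b' : Equiv.Perm (Fin m)) :
    normHamming (prodPerm a b) (prodPerm a' b') ≤ normHamming a a' + normHamming b b' := by
  classical
  rcases Nat.eq_zero_or_pos (n * m) with h0 | hpos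
  · have h0' : ((n * m : ℕ) : ℝ) = 0 := by exact_mod_cast h0
    rw [normHamming, h0', div_zero]
    exact add_nonneg (normHamming_nonneg _ _) (normHamming_nonneg _ _)
  have hn : 0 < n := Nat.pos_of_mul_pos_right hpos
  have hm : 0 < m := Nat.pos_of_mul_pos_left hpos
  have hn' : (0 : ℝ) < n := by exact_mod_cast hn
  have hm' : (0 : ℝ) < m := by exact_mod_cast hm
  rw [prodPerm, prodPerm, normHamming_permCongr, normHamming_eq_card, normHamming_eq_card]
  have hsub : (Finset.univ.filter fun x : Fin n × Fin m =>
      (Equiv.prodCongr a b) x ≠ (Equiv.prodCongr a' b') x) ⊆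
      (Finset.univ.filter fun x => a x ≠ a' x) ×ˢ Finset.univ ∪
        Finset.univ ×ˢ (Finset.univ.filter fun x => b x ≠ b' x) := by
    intro x hx
    simp only [Finset.mem_filter, Finset.mem_univ, true_and, Finset.mem_union, Finset.mem_product,
      and_true, Equiv.prodCongr_apply, Prod.map, ne_eq, Prod.mk.injEq] at hx ⊢
    tauto
  have h1 := Nat.cast_le (α := ℝ).mpr ((Finset.card_le_card hsub).trans (Finset.card_union_le _ _))
  rw [Nat.cast_add, Finset.card_product, Finset.card_product, Finset.card_univ, Finset.card_univ,
    Fintype.card_fin, Fintype.card_fin, Nat.cast_mul, Nat.cast_mul] at h1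
  rw [div_add_div _ _ hn'.ne' hm'.ne', Nat.cast_mul]
  gcongr

theorem normHamming_le_normHamming_prodPerm_left {n m : ℕ} (hm : 0 < m)
    (a a' : Equiv.Perm (Fin n)) (b b' : Equiv.Perm (Fin m)) :
    normHamming a a' ≤ normHamming (prodPerm a b) (prodPerm a' b') := by
  classical
  rw [prodPerm, prodPerm, normHamming_permCongr, normHamming_eq_card, Nat.cast_mul,
    ← mul_div_mul_right (c := (m : ℝ)) _ _ (by exact_mod_cast hm.ne')]
  gcongr
  have hsub : (Finset.univ.filter fun x => a x ≠ a' x) ×ˢ (Finset.univ : Finset (Fin m)) ⊆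
      Finset.univ.filter fun x : Fin n × Fin m =>
        (Equiv.prodCongr a b) x ≠ (Equiv.prodCongr a' b') x := by
    intro x hx
    simp only [Finset.mem_filter, Finset.mem_univ, true_and, Finset.mem_product, and_true,
      Equiv.prodCongr_apply, Prod.map, ne_eq, Prod.mk.injEq] at hx ⊢
    tauto
  have h1 := Finset.card_le_card hsub
  rw [Finset.card_product, Finset.card_univ, Fintype.card_fin] at h1
  exact_mod_cast h1

theorem normHamming_le_normHamming_prodPerm_right {n m : ℕ} (hn : 0 < n)
    (a a' : Equiv.Perm (Fin n)) (b b' : Equiv.Perm (Fin m)) :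
    normHamming b b' ≤ normHamming (prodPerm a b) (prodPerm a' b') := by
  classical
  rw [prodPerm, prodPerm, normHamming_permCongr, normHamming_eq_card, Nat.cast_mul,
    ← mul_div_mul_left (c := (n : ℝ)) _ _ (by exact_mod_cast hn.ne')]
  gcongr
  have hsub : (Finset.univ : Finset (Fin n)) ×ˢ (Finset.univ.filter fun x => b x ≠ b' x) ⊆
      Finset.univ.filter fun x : Fin n × Fin m =>
        (Equiv.prodCongr a b) x ≠ (Equiv.prodCongr a' b') x := by
    intro x hx
    simp only [Finset.mem_filter, Finset.mem_univ, true_and, Finset.mem_product,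
      Equiv.prodCongr_apply, Prod.map, ne_eq, Prod.mk.injEq] at hx ⊢
    tauto
  have h1 := Finset.card_le_card hsub
  rw [Finset.card_product, Finset.card_univ, Fintype.card_fin] at h1
  exact_mod_cast h1

/-! ### Non-conjugate factors for a non-amenable group -/

open Classical in
/-- The two factors of a product action are far from conjugate if the points of the second factor
are good for sets much larger than the first factor. -/
theorem false_of_conj_of_expanding {Γ : Type*} [Group Γ] {n m : ℕ} (hn : 0 < n) (hm : 0 < m)
    {φ : Γ → Equiv.Perm (Fin n)} {ψ : Γ → Equiv.Perm (Fin m)} {F : Finset Γ}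
    (hF : ∀ g ∈ F, g⁻¹ ∈ F) {η : ℝ} (hη : 0 < η)
    (hexp : ∀ T : Finset Γ, T.Nonempty → ∃ g ∈ F,
      η * T.card < ((T.filter fun t => g * t ∉ T).card : ℝ))
    (hbad : ((Finset.univ.filter fun x => ¬ GoodAt ψ ((insert 1 F) ^ (n + 1)) x).card : ℝ)
      ≤ 1 / (2 * n) * m)
    {δ : ℝ} (hδ : F.card * δ < η / 2) (s : Equiv.Perm (Fin (n * m)))
    (hs : ∀ g ∈ F, normHamming (prodPerm 1 (ψ g) * s) (s * prodPerm (φ g) 1) ≤ δ) : False := by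
  set e : Fin n × Fin m ≃ Fin (n * m) := finProdFinEquiv with he
  set t : Equiv.Perm (Fin n × Fin m) := e.permCongr.symm s with ht
  set a : Γ → Equiv.Perm (Fin n × Fin m) := fun g => Equiv.prodCongr (φ g) 1 with ha
  set b : Γ → Equiv.Perm (Fin n × Fin m) := fun g => Equiv.prodCongr 1 (ψ g) with hb
  set L := (insert 1 F) ^ (n + 1) with hL
  have hn' : (0 : ℝ) < n := by exact_mod_cast hn
  have hm' : (0 : ℝ) < m := by exact_mod_cast hm
  have hconj : ∀ g ∈ F,
      ((Finset.univ.filter fun x => b g (t x) ≠ t (a g x)).card : ℝ) ≤ δ * (n * m) := by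
    intro g hg
    have h1 := hs g hg
    have e1 : prodPerm 1 (ψ g) * s = e.permCongr (b g * t) := by
      ext x
      simp [prodPerm, ht, hb, ← he]
    have e2 : s * prodPerm (φ g) 1 = e.permCongr (t * a g) := by
      ext x
      simp [prodPerm, ht, ha, ← he]
    rw [e1, e2, normHamming_permCongr, div_le_iff₀ (by exact_mod_cast Nat.mul_pos hn hm),
      Nat.cast_mul] at h1
    exact h1
  have hgood : ∀ x : Fin n × Fin m, GoodAt ψ L x.2 → GoodAt b L x := by
    intro x hx
    refine ⟨fun g hg h hh => Prod.ext rfl (hx.1 g hg h hh), fun g hg h hh hgh => ?_⟩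
    exact hx.2 hg hh (congrArg Prod.snd hgh)
  -- Images under `t` of the slices preserved by `a`; approximate conjugacy makes them nearly
  -- invariant under `b`.
  set piece : Fin m → Finset (Fin n × Fin m) :=
    fun j => Finset.univ.image fun i => t (i, j) with hpiece
  have hpiece_card : ∀ j, (piece j).card = n := by
    intro j
    rw [hpiece, Finset.card_image_of_injective, Finset.card_univ, Fintype.card_fin]
    intro i i' h
    exact congrArg Prod.fst (t.injective h)
  set J := Finset.univ.filter fun j => ∀ x ∈ piece j, GoodAt ψ L x.2 with hJ
  -- At most `n * (m / (2 n)) = m / 2` points of the product are bad, and each spoils only one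
  -- piece.
  have hJcard : (m : ℝ) / 2 ≤ J.card := by
    have h1 : (Finset.univ.filter fun j => ¬ ∀ x ∈ piece j, GoodAt ψ L x.2) ⊆
        ((Finset.univ : Finset (Fin n)) ×ˢ
          (Finset.univ.filter fun x => ¬ GoodAt ψ L x)).image fun x => (t.symm x).2 := by
      intro j hj
      have hj := (Finset.mem_filter.mp hj).2
      push Not at hj
      obtain ⟨x, hx, hxb⟩ := hj
      obtain ⟨i, -, rfl⟩ := Finset.mem_image.mp hx
      refine Finset.mem_image.mpr ⟨t (i, j), ?_, by simp⟩
      exact Finset.mem_product.mpr ⟨Finset.mem_univ _, Finset.mem_filter.mpr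
        ⟨Finset.mem_univ _, hxb⟩⟩
    have h2 := Nat.cast_le (α := ℝ).mpr ((Finset.card_le_card h1).trans Finset.card_image_le)
    rw [Finset.card_product, Finset.card_univ, Fintype.card_fin, Nat.cast_mul] at h2
    have h3 := h2.trans (mul_le_mul_of_nonneg_left hbad hn'.le)
    have h4 := Finset.card_filter_add_card_filter_not (s := (Finset.univ : Finset (Fin m)))
      (fun j => ∀ x ∈ piece j, GoodAt ψ L x.2)
    rw [Finset.card_univ, Fintype.card_fin] at h4
    have h5 : (J.card : ℝ) +
        ((Finset.univ.filter fun j => ¬ ∀ x ∈ piece j, GoodAt ψ L x.2).card : ℝ) = m := by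
      exact_mod_cast h4
    have h6 : (n : ℝ) * (1 / (2 * n) * m) = m / 2 := by
      field_simp
    linarith
  have hlow : ∀ j ∈ J, η * n ≤ ∑ g ∈ F, (((piece j).filter fun x => b g x ∉ piece j).card : ℝ) := by
    intro j hj
    have h1 := card_le_boundary_of_goodAt (σ := b) hF hexp (piece j) (hpiece_card j).le
      fun x hx => hgood x ((Finset.mem_filter.mp hj).2 x hx)
    rw [hpiece_card j] at h1
    refine h1.trans (le_of_eq (Finset.sum_congr rfl fun g _ => ?_))
    congr!
  -- Where `b g` and `a g` intertwine exactly, the point stays in its piece, so boundary points of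
  -- the disjoint pieces come from the exceptional set of `hconj`.
  have hup : ∀ g ∈ F, ∑ j ∈ J, (((piece j).filter fun x => b g x ∉ piece j).card : ℝ) ≤
      δ * (n * m) := by
    intro g hg
    refine le_trans ?_ (hconj g hg)
    rw [← Nat.cast_sum, ← Finset.card_biUnion, Nat.cast_le]
    · rw [← Finset.card_image_of_injective
        (Finset.univ.filter fun x => b g (t x) ≠ t (a g x)) t.injective]
      refine Finset.card_le_card fun x hx => ?_
      obtain ⟨j, -, hx⟩ := Finset.mem_biUnion.mp hx
      obtain ⟨hx, hbx⟩ := Finset.mem_filter.mp hx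
      obtain ⟨i, -, rfl⟩ := Finset.mem_image.mp hx
      refine Finset.mem_image_of_mem _ (Finset.mem_filter.mpr ⟨Finset.mem_univ _, fun h => hbx ?_⟩)
      rw [h]
      exact Finset.mem_image.mpr ⟨φ g i, Finset.mem_univ _, rfl⟩
    · intro j _ j' _ hjj
      refine Finset.disjoint_filter_filter (Finset.disjoint_left.mpr fun x hx hx' => hjj ?_)
      obtain ⟨i, -, rfl⟩ := Finset.mem_image.mp hx
      obtain ⟨i', -, h⟩ := Finset.mem_image.mp hx'
      exact (congrArg Prod.snd (t.injective h)).symm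
  have h1 : (J.card : ℝ) * (η * n) ≤ F.card * (δ * (n * m)) := by
    calc (J.card : ℝ) * (η * n) = ∑ j ∈ J, η * n := by rw [Finset.sum_const, nsmul_eq_mul]
      _ ≤ ∑ j ∈ J, ∑ g ∈ F, (((piece j).filter fun x => b g x ∉ piece j).card : ℝ) :=
        Finset.sum_le_sum hlow
      _ = ∑ g ∈ F, ∑ j ∈ J, (((piece j).filter fun x => b g x ∉ piece j).card : ℝ) :=
        Finset.sum_comm
      _ ≤ ∑ g ∈ F, δ * (n * m) := Finset.sum_le_sum hup
      _ = _ := by rw [Finset.sum_const, nsmul_eq_mul]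
  have h2 := mul_le_mul_of_nonneg_right hJcard (by positivity : 0 ≤ η * n)
  have h3 := mul_lt_mul_of_pos_right hδ (by positivity : (0 : ℝ) < n * m)
  linarith

theorem isAmenable_of_areConjugate {Γ : Type*} [Group Γ] [Countable Γ] (hΓ : IsSofic Γ)
    {𝒰 : Ultrafilter ℕ} (h𝒰 : (𝒰 : Filter ℕ) ≤ cofinite)
    (h : ∀ n : ℕ → ℕ, (∀ k, 0 < n k) → ∀ π : Γ × Γ →* UniversalSoficGroup 𝒰 n,
      IsSoficRepresentation π → AreConjugate (π.comp (MonoidHom.inl Γ Γ))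
        ((π.comp (flip Γ).toMonoidHom).comp (MonoidHom.inl Γ Γ))) : IsAmenable Γ := by
  classical
  rw [isAmenable_iff]
  by_contra! hcon
  obtain ⟨F₀, η, hη, hF₀⟩ := hcon
  set F := F₀ ∪ F₀⁻¹ with hFdef
  have hF : ∀ g ∈ F, g⁻¹ ∈ F := by
    intro g hg
    simp only [hFdef, Finset.mem_union, Finset.mem_inv', inv_inv] at hg ⊢
    exact hg.symm
  obtain ⟨Φ, hΦ, hΦ'⟩ := exists_exhausting_finsets Γ
  choose n φ hn hφ1 hφm hφf using fun k : ℕ =>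
    hΓ.exists_approx (Φ k) (ε := 1 / ((k : ℝ) + 1)) (by positivity)
  set L : ℕ → Finset Γ := fun k => (insert 1 F) ^ (n k + 1) with hL
  -- The second term turns the bound of `card_not_goodAt_le` into `m k / (2 n k)`; it depends on `n
  -- k`, so `ψ k` is chosen after `φ k`.
  set ε : ℕ → ℝ := fun k => min (1 / ((k : ℝ) + 1))
    (1 / (2 * n k) / (2 * ((L k).card : ℝ) ^ 2 + 1)) with hε
  have hε0 : ∀ k, 0 < ε k := fun k => by
    have : (0 : ℝ) < n k := by exact_mod_cast hn k
    exact lt_min (by positivity) (by positivity)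
  choose m ψ hm hψ1 hψm hψf using fun k : ℕ => hΓ.exists_approx (Φ k ∪ L k) (hε0 k)
  have hbad : ∀ k, ((Finset.univ.filter fun x => ¬ GoodAt (ψ k) (L k) x).card : ℝ) ≤
      1 / (2 * n k) * m k := by
    intro k
    have h1 := card_not_goodAt_le (σ := ψ k) (L := L k)
      (fun g hg h hh => hψm k g (Finset.mem_union_right _ hg) h (Finset.mem_union_right _ hh))
      (fun g hg h hh => hψf k g (Finset.mem_union_right _ hg) h (Finset.mem_union_right _ hh))
      (hε0 k).le
    have h2 : ε k * (2 * ((L k).card : ℝ) ^ 2 + 1) ≤ 1 / (2 * n k) := by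
      rw [← le_div_iff₀ (by positivity)]
      exact min_le_right _ _
    have h3 : 2 * ((L k).card : ℝ) ^ 2 * ε k * m k ≤ 1 / (2 * n k) * m k := by
      gcongr
      linarith [hε0 k]
    convert h1.trans h3
  have hev : ∀ j, ∀ᶠ k in (𝒰 : Filter ℕ), j ≤ k := fun j => by
    rw [Nat.cofinite_eq_atTop] at h𝒰
    exact h𝒰 (eventually_ge_atTop j)
  have hmem : ∀ g, ∀ᶠ k in (𝒰 : Filter ℕ), g ∈ Φ k := fun g => by
    obtain ⟨j, hj⟩ := hΦ' g
    filter_upwards [hev j] with k hk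
    exact hΦ hk hj
  have hlim : Tendsto (fun k : ℕ => 1 / ((k : ℝ) + 1)) (𝒰 : Filter ℕ) (𝓝 0) := by
    rw [Nat.cofinite_eq_atTop] at h𝒰
    exact tendsto_one_div_add_atTop_nhds_zero_nat.mono_left h𝒰
  have hφM : ∀ g h, Tendsto (fun k => normHamming (φ k (g * h)) (φ k g * φ k h))
      (𝒰 : Filter ℕ) (𝓝 0) := fun g h => by
    refine squeeze_zero' (Eventually.of_forall fun k => normHamming_nonneg _ _) ?_ hlim
    filter_upwards [hmem g, hmem h] with k hg hh
    exact hφm k g hg h hh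
  have hψM : ∀ g h, Tendsto (fun k => normHamming (ψ k (g * h)) (ψ k g * ψ k h))
      (𝒰 : Filter ℕ) (𝓝 0) := fun g h => by
    refine squeeze_zero' (Eventually.of_forall fun k => normHamming_nonneg _ _) ?_ hlim
    filter_upwards [hmem g, hmem h] with k hg hh
    exact (hψm k g (Finset.mem_union_left _ hg) h (Finset.mem_union_left _ hh)).trans
      (min_le_left _ _)
  have hlim' : Tendsto (fun k : ℕ => 1 - 1 / ((k : ℝ) + 1)) (𝒰 : Filter ℕ) (𝓝 1) := by
    simpa using hlim.const_sub 1
  set θ : ∀ k, Γ × Γ → Equiv.Perm (Fin (n k * m k)) :=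
    fun k p => prodPerm (φ k p.1) (ψ k p.2) with hθ
  have hθM : ∀ p q, Tendsto (fun k => normHamming (θ k (p * q)) (θ k p * θ k q))
      (𝒰 : Filter ℕ) (𝓝 0) := fun p q => by
    have h1 := (hφM p.1 q.1).add (hψM p.2 q.2)
    rw [add_zero] at h1
    refine squeeze_zero (fun k => normHamming_nonneg _ _) (fun k => ?_) h1
    simp only [hθ]
    rw [← prodPerm_mul]
    exact normHamming_prodPerm_le _ _ _ _
  -- A product permutation moves every point that one coordinate moves, so one nontrivial coordinate
  -- suffices.
  have hθF : ∀ p, p ≠ 1 → Tendsto (fun k => normHamming (θ k p) 1) (𝒰 : Filter ℕ) (𝓝 1) := by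
    intro p hp
    refine tendsto_of_tendsto_of_tendsto_of_le_of_le' hlim' tendsto_const_nhds ?_
      (Eventually.of_forall fun k => normHamming_le_one _ _)
    by_cases hp1 : p.1 = 1
    · have hp2 : p.2 ≠ 1 := fun h => hp (Prod.ext hp1 h)
      filter_upwards [hmem p.2, hmem 1] with k hk hk1
      have h1 := hψf k p.2 (Finset.mem_union_left _ hk) 1 (Finset.mem_union_left _ hk1) hp2
      rw [hψ1] at h1
      have h2 := normHamming_le_normHamming_prodPerm_right (hn k) (φ k p.1) 1 (ψ k p.2) 1
      rw [prodPerm_one_one] at h2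
      have h3 : ε k ≤ 1 / ((k : ℝ) + 1) := min_le_left _ _
      exact le_trans (by linarith) h2
    · filter_upwards [hmem p.1, hmem 1] with k hk hk1
      have h1 := hφf k p.1 hk 1 hk1 hp1
      rw [hφ1] at h1
      have h2 := normHamming_le_normHamming_prodPerm_left (hm k) (φ k p.1) 1 (ψ k p.2) 1
      rw [prodPerm_one_one] at h2
      exact h1.trans h2
  obtain ⟨s, hs⟩ := h (fun k => n k * m k) (fun k => Nat.mul_pos (hn k) (hm k))
    (homOfApprox θ hθM) (isSoficRepresentation_homOfApprox θ hθM hθF)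
  obtain ⟨s, rfl⟩ := QuotientGroup.mk_surjective s
  have hconj : ∀ g : Γ, Tendsto (fun k => normHamming (prodPerm 1 (ψ k g) * s k)
      (s k * prodPerm (φ k g) 1)) (𝒰 : Filter ℕ) (𝓝 0) := by
    intro g
    have h1 := hs g
    rw [eq_mul_inv_iff_mul_eq] at h1
    have h2 : (QuotientGroup.mk ((fun k => θ k (1, g)) * s) :
          UniversalSoficGroup 𝒰 fun k => n k * m k) =
        QuotientGroup.mk (s * fun k => θ k (g, 1)) := by
      rw [QuotientGroup.mk_mul, QuotientGroup.mk_mul]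
      exact h1
    refine (mk_eq_mk_iff.mp h2).congr fun k => ?_
    simp only [hθ, Pi.mul_apply, hφ1, hψ1]
  set δ : ℝ := η / 2 / (F.card + 1) with hδ
  have hδ0 : 0 < δ := by positivity
  have hall : ∀ᶠ k in (𝒰 : Filter ℕ), ∀ g ∈ F, normHamming (prodPerm 1 (ψ k g) * s k)
      (s k * prodPerm (φ k g) 1) ≤ δ :=
    (eventually_all_finset F).mpr fun g _ => (hconj g).eventually_le_const hδ0
  obtain ⟨k, hk⟩ := hall.exists
  refine false_of_conj_of_expanding (hn k) (hm k) hF hη (fun T hT => ?_) (δ := δ) ?_ ?_ (s k) hk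
  · obtain ⟨g, hg, hlt⟩ := hF₀ T hT
    refine ⟨g, Finset.mem_union_left _ hg, ?_⟩
    convert hlt
  · convert hbad k
  · have h1 : δ * (F.card + 1) = η / 2 := by
      rw [hδ]
      field_simp
    linarith

theorem IsSoficRepresentation.comp {Γ Λ : Type*} [Group Γ] [Group Λ] {𝒰 : Ultrafilter ℕ}
    {n : ℕ → ℕ} {π : Γ →* UniversalSoficGroup 𝒰 n} (hπ : IsSoficRepresentation π)
    {f : Λ →* Γ} (hf : Function.Injective f) : IsSoficRepresentation (π.comp f) :=
  ⟨hπ.1.comp hf, fun g hg σ hσ => hπ.2 (f g)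
    (fun h => hg (hf (h.trans (map_one f).symm))) σ hσ⟩

end Sofic

theorem mainTheorem7 {Γ : Type*} [Group Γ] [Countable Γ] (hΓ : Sofic.IsSofic Γ)
    (𝒰 : Ultrafilter ℕ) (h𝒰 : (𝒰 : Filter ℕ) ≤ Filter.cofinite) :
    List.TFAE [
      Sofic.IsAmenable Γ,
      ∀ n : ℕ → ℕ, (∀ k, 0 < n k) →
        ∀ π₁ π₂ : Γ →* Sofic.UniversalSoficGroup 𝒰 n,
          Sofic.IsSoficRepresentation π₁ → Sofic.IsSoficRepresentation π₂ →
            Sofic.AreConjugate π₁ π₂,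
      ∀ n : ℕ → ℕ, (∀ k, 0 < n k) →
        ∀ π : Γ × Γ →* Sofic.UniversalSoficGroup 𝒰 n,
          Sofic.IsSoficRepresentation π →
            Sofic.AreConjugate π (π.comp (Sofic.flip Γ).toMonoidHom),
      ∀ n : ℕ → ℕ, (∀ k, 0 < n k) →
        ∀ π : Γ × Γ →* Sofic.UniversalSoficGroup 𝒰 n,
          Sofic.IsSoficRepresentation π →
            Sofic.AreConjugate (π.comp (MonoidHom.inl Γ Γ))
              ((π.comp (Sofic.flip Γ).toMonoidHom).comp (MonoidHom.inl Γ Γ))] := by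
  have hinl : Function.Injective (MonoidHom.inl Γ Γ) := fun g h hgh => congrArg Prod.fst hgh
  have hflip : Function.Injective (Sofic.flip Γ).toMonoidHom := (Sofic.flip Γ).injective
  tfae_have 1 → 2 := fun h n hn π₁ π₂ h₁ h₂ => Sofic.areConjugate_of_isAmenable h h𝒰 hn h₁ h₂
  tfae_have 1 → 3 := fun h n hn π hπ =>
    Sofic.areConjugate_of_isAmenable (h.prod h) h𝒰 hn hπ (hπ.comp hflip)
  tfae_have 2 → 4 := fun h n hn π hπ =>
    h n hn _ _ (hπ.comp hinl) ((hπ.comp hflip).comp hinl)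
  tfae_have 3 → 4 := fun h n hn π hπ =>
    let ⟨s, hs⟩ := h n hn π hπ
    ⟨s, fun g => hs (MonoidHom.inl Γ Γ g)⟩
  tfae_have 4 → 1 := Sofic.isAmenable_of_areConjugate hΓ h𝒰
  tfae_finish
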